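/- **Definitions.** Let $A,B$ be $C^*$-algebras. A *right-Hilbert $A$–$B$ bimodule* is a right Hilbert $B$-module $X$ that is full (the closed linear span of $\langle X,X\rangle_B$ is $B$), together with a nondegenerate left action of $A$ (the closed linear span of $A\cdot X$ is $X$) satisfying $a\cdot(x\cdot b)=(a\cdot x)\cdot b$ and $\langle a\cdot x,y\rangle_B=\langle x,a^*\cdot y\rangle_B$. An *isomorphism* of right-Hilbert $A$–$B$ bimodules is a linear bijection preserving the left action, the right action and the $B$-valued inner product. An *$A$–$B$ imprimitivity bimodule* ${}_AX_B$ is a right-Hilbert $A$–$B$ bimodule that is also a full left Hilbert $A$-module, with ${}_A\langle x,y\rangle\cdot z=x\cdot\langle y,z\rangle_B$ and ${}_A\langle x\cdot b,y\rangle={}_A\langle x,y\cdot b^*\rangle$. Its *linking algebra* is the $C^*$-algebra $L(X)$ of matrices $\begin{pmatrix}a&x\\ \widetilde z&b\end{pmatrix}$ ($a\in A$, $b\in B$, $x,z\in X$, where $\widetilde z$ denotes $z$ viewed in the conjugate bimodule $\widetilde X$, with $b\cdot\widetilde z=(z\cdot b^*)^{\sim}$, $\widetilde z\cdot a=(a^*\cdot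 z)^{\sim}$) with $$\begin{pmatrix}a&x\\ \widetilde z&b\end{pmatrix}\begin{pmatrix}a'&x'\\ \widetilde{z'}&b'\end{pmatrix}=\begin{pmatrix}aa'+{}_A\langle x,z'\rangle&a\cdot x'+x\cdot b'\\ \widetilde z\cdot a'+b\cdot\widetilde{z'}&\langle z,x'\rangle_B+bb'\end{pmatrix},\qquad \begin{pmatrix}a&x\\ \widetilde z&b\end{pmatrix}^*=\begin{pmatrix}a^*&z\\ \widetilde x&b^*\end{pmatrix},$$ and its unique complete $C^*$-norm, namely the operator norm for the action on the Hilbert module $X\oplus B$. Let $p_{L(X)}=\begin{pmatrix}1&0\\0&0\end{pmatrix}$ and $q_{L(X)}=\begin{pmatrix}0&0\\0&1\end{pmatrix}$ in the multiplier algebra $M(L(X))$; these identify $A=pL(X)p$, $B=qL(X)q$, $X=pL(X)q$. The actions of $L(X)$ and $L(Y)$ on a right-Hilbert $L(X)$–$L(Y)$ bimodule extend to $M(L(X))$ and $M(L(Y))$. Finally $X\otimes_BW$ is the internal tensor product: the Hausdorff completion of the algebraic tensor product $X\odot W$ for $\langle x\otimes w,x'\otimes w'\rangle=\langle w,\langle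 x,x'\rangle_B\cdot w'\rangle$. **Proposition.** Let $A,B,C,D$ be $C^*$-algebras, let ${}_AX_B$ and ${}_CY_D$ be imprimitivity bimodules, and let $Z$ be a right-Hilbert $L(X)$–$L(Y)$ bimodule. Give the corners below the actions and inner products restricted from $Z$; the $L(Y)$-valued inner products of elements of the corners lie in $C=p_{L(Y)}L(Y)p_{L(Y)}$ in case (i), and in $D=q_{L(Y)}L(Y)q_{L(Y)}$ in cases (ii) and (iii). Then 1. $pZp=p_{L(X)}Zp_{L(Y)}$ is a right-Hilbert $A$–$C$ bimodule; 2. $qZq=q_{L(X)}Zq_{L(Y)}$ is a right-Hilbert $B$–$D$ bimodule; 3. $pZq=p_{L(X)}Zq_{L(Y)}$ is a right-Hilbert $A$–$D$ bimodule; 4. there is an isomorphism $\Phi:X\otimes_B qZq\to pZq$ of right-Hilbert $A$–$D$ bimodules such that $\Phi(x\otimes z)=x\cdot z$ for all $x\in X$, $z\in qZq$; 5. there is an isomorphism $\Psi:pZp\otimes_C Y\to pZq$ of right-Hilbert $A$–$D$ bimodules such that $\Psi(w\otimes y)=w\cdot y$ for all $w\in pZp$, $y\in Y$. -/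

import Mathlib

open scoped RightActions TensorProduct ComplexConjugate

set_option linter.unusedSectionVars false
set_option linter.unusedVariables false

noncomputable section

namespace HilbertBimod

/-! ### Hilbert modules and right-Hilbert bimodules

Throughout, `A`, `B`, ... are (not necessarily unital) C⋆-algebras, a left action of `A` is written
`a • x`, a right action of `B` is written `x <• b` (that is, `MulOpposite.op b • x`), and a
`B`-valued inner product is written `inner B x y`; it is linear in the second variable. -/

/-- A pre-Hilbert module: a right `B`-module with a `B`-valued positive semidefinite sesquilinear
form (positive elements of a C⋆-algebra are those of the form `star c * c`). -/
class IsPreHilbertModule (B V : Type*) [NonUnitalCStarAlgebra B] [AddCommGroup V] [Module ℂ V]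
    [SMul Bᵐᵒᵖ V] [Inner B V] : Prop where
  add_rsmul (x y : V) (b : B) : (x + y) <• b = x <• b + y <• b
  rsmul_add (x : V) (b c : B) : x <• (b + c) = x <• b + x <• c
  rsmul_mul (x : V) (b c : B) : x <• (b * c) = (x <• b) <• c
  smul_rsmul (r : ℂ) (x : V) (b : B) : (r • x) <• b = r • (x <• b)
  rsmul_smul (r : ℂ) (x : V) (b : B) : x <• (r • b) = r • (x <• b)
  inner_add_right (x y z : V) : inner B x (y + z) = inner B x y + inner B x z
  inner_smul_right (r : ℂ) (x y : V) : inner B x (r • y) = r • inner B x y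
  inner_rsmul_right (x y : V) (b : B) : inner B x (y <• b) = inner B x y * b
  star_inner (x y : V) : star (inner B x y) = inner B y x
  inner_self_nonneg (x : V) : ∃ c : B, inner B x x = star c * c

/-- A Hilbert `B`-module: a pre-Hilbert module whose form is definite, and which is complete in
the norm `‖x‖ = ‖⟨x, x⟩‖ ^ (1 / 2)`. -/
class IsHilbertModule (B X : Type*) [NonUnitalCStarAlgebra B] [NormedAddCommGroup X]
    [NormedSpace ℂ X] [SMul Bᵐᵒᵖ X] [Inner B X] : Prop extends IsPreHilbertModule B X where
  inner_self_eq_zero (x : X) : inner B x x = 0 → x = 0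
  norm_sq_eq (x : X) : ‖x‖ ^ 2 = ‖inner B x x‖
  complete : CompleteSpace X

/-- A left action of `A` on a pre-Hilbert `B`-module by adjointable operators. -/
class IsAdjointableAction (A B V : Type*) [NonUnitalCStarAlgebra A] [NonUnitalCStarAlgebra B]
    [AddCommGroup V] [Module ℂ V] [SMul A V] [SMul Bᵐᵒᵖ V] [Inner B V] : Prop where
  lsmul_add (a : A) (x y : V) : a • (x + y) = a • x + a • y
  add_lsmul (a a' : A) (x : V) : (a + a') • x = a • x + a' • x
  mul_lsmul (a a' : A) (x : V) : (a * a') • x = a • (a' • x)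
  lsmul_smul (r : ℂ) (a : A) (x : V) : a • (r • x) = r • (a • x)
  smul_lsmul (r : ℂ) (a : A) (x : V) : (r • a) • x = r • (a • x)
  lsmul_rsmul (a : A) (x : V) (b : B) : a • (x <• b) = (a • x) <• b
  inner_lsmul_left (a : A) (x y : V) : inner B (a • x) y = inner B x (star a • y)

/-- A right-Hilbert `A`–`B` bimodule: a full Hilbert `B`-module together with a nondegenerate left
action of `A` by adjointable operators. -/
class IsRightHilbertBimodule (A B X : Type*) [NonUnitalCStarAlgebra A] [NonUnitalCStarAlgebra B]
    [NormedAddCommGroup X] [NormedSpace ℂ X] [SMul A X] [SMul Bᵐᵒᵖ X] [Inner B X] : Prop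
    extends IsHilbertModule B X, IsAdjointableAction A B X where
  full : Dense (Submodule.span ℂ {b : B | ∃ x y : X, b = inner B x y} : Set B)
  nondegenerate : Dense (Submodule.span ℂ {z : X | ∃ (a : A) (x : X), z = a • x} : Set X)

/-! ### Basic estimates -/

section Basic

attribute [local instance] CStarAlgebra.spectralOrder CStarAlgebra.spectralOrderedRing

variable {A B V : Type*} [NonUnitalCStarAlgebra A] [NonUnitalCStarAlgebra B]

theorem exists_star_mul_add {b c : B} (hb : ∃ d, b = star d * d) (hc : ∃ d, c = star d * d) :
    ∃ d, b + c = star d * d := by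
  rw [← CStarAlgebra.nonneg_iff_eq_star_mul_self] at *
  exact add_nonneg hb hc

theorem norm_le_norm_add {b c : B} (hb : ∃ d, b = star d * d) (hc : ∃ d, c = star d * d) :
    ‖b‖ ≤ ‖b + c‖ := by
  rw [← CStarAlgebra.nonneg_iff_eq_star_mul_self] at *
  exact CStarAlgebra.norm_le_norm_of_nonneg_of_le hb (le_add_of_nonneg_right hc)

section Pre

variable [AddCommGroup V] [Module ℂ V] [SMul Bᵐᵒᵖ V] [Inner B V] [IsPreHilbertModule B V]

theorem inner_add_right (x y z : V) : inner B x (y + z) = inner B x y + inner B x z :=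
  IsPreHilbertModule.inner_add_right x y z

theorem inner_smul_right (r : ℂ) (x y : V) : inner B x (r • y) = r • inner B x y :=
  IsPreHilbertModule.inner_smul_right r x y

theorem inner_rsmul_right (x y : V) (b : B) : inner B x (y <• b) = inner B x y * b :=
  IsPreHilbertModule.inner_rsmul_right x y b

theorem star_inner (x y : V) : star (inner B x y) = inner B y x :=
  IsPreHilbertModule.star_inner x y

theorem inner_self_nonneg (x : V) : ∃ c : B, inner B x x = star c * c :=
  IsPreHilbertModule.inner_self_nonneg x

variable (B) in
/-- The form as a linear map in its second variable. -/
def innerRight (x : V) : V →ₗ[ℂ] B where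
  toFun := inner B x
  map_add' := inner_add_right x
  map_smul' r y := inner_smul_right r x y

theorem inner_add_left (x y z : V) : inner B (x + y) z = inner B x z + inner B y z := by
  rw [← star_inner, inner_add_right, star_add, star_inner, star_inner]

theorem inner_smul_left (r : ℂ) (x y : V) : inner B (r • x) y = conj r • inner B x y := by
  rw [← star_inner, inner_smul_right, star_smul, star_inner]; rfl

theorem inner_rsmul_left (x y : V) (b : B) : inner B (x <• b) y = star b * inner B x y := by
  rw [← star_inner, inner_rsmul_right, star_mul, star_inner]

theorem inner_zero_right (x : V) : inner B x 0 = 0 := (innerRight B x).map_zero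

theorem inner_zero_left (x : V) : inner B 0 x = 0 := by
  rw [← star_inner, inner_zero_right, star_zero]

theorem inner_neg_right (x y : V) : inner B x (-y) = - inner B x y := (innerRight B x).map_neg y

theorem inner_sub_right (x y z : V) : inner B x (y - z) = inner B x y - inner B x z :=
  (innerRight B x).map_sub y z

theorem inner_sub_left (x y z : V) : inner B (x - y) z = inner B x z - inner B y z := by
  rw [← star_inner, inner_sub_right, star_sub, star_inner, star_inner]

theorem inner_sum_right {ι : Type*} (s : Finset ι) (x : V) (y : ι → V) :
    inner B x (∑ i ∈ s, y i) = ∑ i ∈ s, inner B x (y i) := map_sum (innerRight B x) y s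

theorem inner_sum_left {ι : Type*} (s : Finset ι) (x : ι → V) (y : V) :
    inner B (∑ i ∈ s, x i) y = ∑ i ∈ s, inner B (x i) y := by
  rw [← star_inner, inner_sum_right, star_sum]
  exact Finset.sum_congr rfl fun i _ => star_inner _ _

variable (V) in
/-- Right multiplication by an element of `B` as a linear map. -/
def rsmulLin (b : B) : V →ₗ[ℂ] V where
  toFun x := x <• b
  map_add' x y := IsPreHilbertModule.add_rsmul x y b
  map_smul' r x := IsPreHilbertModule.smul_rsmul r x b

theorem sub_rsmul (x y : V) (b : B) : (x - y) <• b = x <• b - y <• b :=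
  (rsmulLin V b).map_sub x y

theorem zero_rsmul (b : B) : (0 : V) <• b = 0 := (rsmulLin V b).map_zero

/-- The Cauchy–Schwarz inequality. -/
theorem norm_inner_sq_le (x y : V) : ‖inner B x y‖ ^ 2 ≤ ‖inner B x x‖ * ‖inner B y y‖ := by
  set b := inner B x y with hb
  have key : ∀ t : ℝ, ‖inner B x x‖ < t → ‖b‖ ^ 2 ≤ t * ‖inner B y y‖ := by
    intro t ht
    have ht0 : 0 < t := (norm_nonneg _).trans_lt ht
    have h1 : 0 ≤ inner B (x <• b - (t : ℂ) • y) (x <• b - (t : ℂ) • y) :=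
      CStarAlgebra.nonneg_iff_eq_star_mul_self.mpr (inner_self_nonneg _)
    have hxx : IsSelfAdjoint (inner B x x) := star_inner x x
    have h2 : star b * inner B x x * b ≤ ‖inner B x x‖ • (star b * b) :=
      CStarAlgebra.star_left_conjugate_le_norm_smul hxx
    have h3 : ‖inner B x x‖ • (star b * b) ≤ t • (star b * b) :=
      smul_le_smul_of_nonneg_right ht.le (star_mul_self_nonneg b)
    have h4 : inner B (x <• b - (t : ℂ) • y) (x <• b - (t : ℂ) • y) =
        star b * inner B x x * b - t • (star b * b) - t • (star b * b)
          + t • (t • inner B y y) := by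
      have hyx : inner B y x = star b := (star_inner x y).symm
      simp only [inner_sub_left, inner_sub_right, inner_rsmul_left, inner_rsmul_right,
        inner_smul_left, inner_smul_right, hyx, ← hb, Complex.conj_ofReal]
      simp only [Complex.coe_smul, smul_mul_assoc, sub_mul, mul_assoc, smul_sub]
      abel
    rw [h4] at h1
    have h5 : t • (star b * b) ≤ t • (t • inner B y y) := by
      have h6 := add_le_add h1 (h2.trans h3)
      rw [zero_add, ← sub_nonneg] at h6
      rw [← sub_nonneg]
      convert h6 using 1
      abel
    have h6 : star b * b ≤ t • inner B y y := (smul_le_smul_iff_of_pos_left ht0).mp h5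
    have h7 := CStarAlgebra.norm_le_norm_of_nonneg_of_le (star_mul_self_nonneg b) h6
    rw [CStarRing.norm_star_mul_self, norm_smul, Real.norm_of_nonneg ht0.le] at h7
    rw [sq]; exact h7
  refine le_of_forall_gt_imp_ge_of_dense ?_ |>.trans le_rfl
  intro r hr
  by_cases h0 : ‖inner B y y‖ = 0
  · have := key (‖inner B x x‖ + 1) (by linarith)
    rw [h0, mul_zero] at this hr
    linarith
  · have hp : 0 < ‖inner B y y‖ := lt_of_le_of_ne (norm_nonneg _) (Ne.symm h0)
    have := key (r / ‖inner B y y‖) (by rw [lt_div_iff₀ hp]; exact hr)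
    rwa [div_mul_cancel₀ _ h0] at this

/-- The seminorm `‖⟨x, x⟩‖ ^ (1 / 2)`. -/
theorem seminormCore : @SeminormedSpace.Core ℂ V _ _ ⟨fun x => √‖inner B x x‖⟩ _ := by
  let _ : Norm V := ⟨fun x => √‖inner B x x‖⟩
  have hn : ∀ x : V, ‖x‖ = √‖inner B x x‖ := fun _ => rfl
  refine ⟨fun x => Real.sqrt_nonneg _, fun c x => ?_, fun x y => ?_⟩
  · rw [hn, hn, inner_smul_left, inner_smul_right, norm_smul, norm_smul, ← mul_assoc,
      RCLike.norm_conj, Real.sqrt_mul (by positivity), Real.sqrt_mul_self (norm_nonneg c)]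
  · have cs : ∀ x y : V, ‖inner B x y‖ ≤ ‖x‖ * ‖y‖ := fun x y => by
      rw [hn, hn, ← Real.sqrt_mul (norm_nonneg _)]
      exact Real.le_sqrt_of_sq_le (norm_inner_sq_le x y)
    have hs : ∀ x : V, ‖inner B x x‖ = ‖x‖ ^ 2 := fun x => by
      rw [hn, Real.sq_sqrt (norm_nonneg _)]
    have h0 : ∀ x : V, 0 ≤ ‖x‖ := fun x => Real.sqrt_nonneg _
    rw [hn (x + y)]
    refine Real.sqrt_le_iff.mpr ⟨add_nonneg (h0 x) (h0 y), ?_⟩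
    rw [inner_add_left, inner_add_right, inner_add_right]
    calc _ ≤ (‖inner B x x‖ + ‖inner B x y‖) + (‖inner B y x‖ + ‖inner B y y‖) :=
          (norm_add_le _ _).trans (add_le_add (norm_add_le _ _) (norm_add_le _ _))
      _ ≤ (‖x‖ ^ 2 + ‖x‖ * ‖y‖) + (‖y‖ * ‖x‖ + ‖y‖ ^ 2) := by
          rw [hs, hs]; gcongr <;> exact cs _ _
      _ = _ := by ring

section Action

variable [SMul A V] [IsAdjointableAction A B V]

/-- Adjointable actions of C⋆-algebras are contractive. -/
theorem norm_inner_lsmul_le (a : A) (x : V) :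
    ‖inner B (a • x) (a • x)‖ ≤ ‖a‖ ^ 2 * ‖inner B x x‖ := by
  have hh : ∃ d : A, ‖a‖ ^ 2 • (star a * a) - star a * (a * star a) * a = star d * d := by
    rw [← CStarAlgebra.nonneg_iff_eq_star_mul_self, sub_nonneg]
    have := CStarAlgebra.star_left_conjugate_le_norm_smul (a := a) (b := a * star a)
      (.mul_star_self a)
    rwa [CStarRing.norm_self_mul_star, ← sq] at this
  obtain ⟨d, hd⟩ := hh
  set y := star a • (a • x) with hy
  have e1 : inner B (a • x) (a • x) = inner B x y := by
    rw [IsAdjointableAction.inner_lsmul_left]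
  have e2 : inner B (d • x) (d • x) = (‖a‖ ^ 2) • inner B x y - inner B y y := by
    rw [IsAdjointableAction.inner_lsmul_left, ← IsAdjointableAction.mul_lsmul (B := B), ← hd, hy]
    have : (‖a‖ ^ 2 • (star a * a) - star a * (a * star a) * a) • x =
        ((‖a‖ ^ 2 : ℝ) : ℂ) • (star a • (a • x)) - star a • (a • (star a • (a • x))) := by
      rw [eq_sub_iff_add_eq]
      simp only [← IsAdjointableAction.mul_lsmul (B := B), ← IsAdjointableAction.add_lsmul (B := B),
        ← IsAdjointableAction.smul_lsmul (B := B), Complex.coe_smul, mul_assoc, sub_add_cancel]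
    rw [this, inner_sub_right, inner_smul_right, Complex.coe_smul]
    congr 1
    rw [IsAdjointableAction.inner_lsmul_left (star a), star_star,
      IsAdjointableAction.inner_lsmul_left a]
  have h1 : ‖inner B y y‖ ≤ ‖a‖ ^ 2 * ‖inner B x y‖ := by
    have := norm_le_norm_add (b := inner B y y) (c := inner B (d • x) (d • x))
      (inner_self_nonneg _) (inner_self_nonneg _)
    rw [e2, add_sub_cancel, norm_smul, Real.norm_of_nonneg (by positivity)] at this
    exact this
  have h2 := norm_inner_sq_le (B := B) x y
  rw [e1]
  by_cases h0 : ‖inner B x y‖ = 0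
  · rw [h0]; positivity
  · have hp : 0 < ‖inner B x y‖ := lt_of_le_of_ne (norm_nonneg _) (Ne.symm h0)
    have h3 : ‖inner B x y‖ ^ 2 ≤ ‖inner B x x‖ * (‖a‖ ^ 2 * ‖inner B x y‖) :=
      h2.trans (by gcongr)
    have : ‖inner B x y‖ * ‖inner B x y‖ ≤ (‖a‖ ^ 2 * ‖inner B x x‖) * ‖inner B x y‖ := by
      nlinarith
    exact le_of_mul_le_mul_right this hp

variable (B V) in
/-- A left action as linear maps. -/
def lsmulLin (a : A) : V →ₗ[ℂ] V where
  toFun x := a • x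
  map_add' := IsAdjointableAction.lsmul_add (B := B) a
  map_smul' r x := IsAdjointableAction.lsmul_smul (B := B) r a x

end Action

end Pre

theorem zero_lsmul [AddCommGroup V] [Module ℂ V] [SMul Bᵐᵒᵖ V] [Inner B V] [SMul A V]
    (h : IsAdjointableAction A B V) (x : V) : (0 : A) • x = 0 := by
  have := h.smul_lsmul 0 0 x
  rwa [zero_smul, zero_smul] at this

theorem lsmul_zero [AddCommGroup V] [Module ℂ V] [SMul Bᵐᵒᵖ V] [Inner B V] [SMul A V]
    (h : IsAdjointableAction A B V) (a : A) : a • (0 : V) = 0 := by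
  have := h.lsmul_smul 0 a 0
  rwa [zero_smul, zero_smul] at this

theorem rsmul_zero [AddCommGroup V] [Module ℂ V] [SMul Bᵐᵒᵖ V] [Inner B V]
    (h : IsPreHilbertModule B V) (x : V) : x <• (0 : B) = 0 := by
  have := h.rsmul_smul 0 x 0
  rwa [zero_smul, zero_smul] at this

section Hilbert

variable {X : Type*} [NormedAddCommGroup X] [NormedSpace ℂ X] [SMul Bᵐᵒᵖ X] [Inner B X]
  [IsHilbertModule B X]

theorem norm_inner_le (x y : X) : ‖inner B x y‖ ≤ ‖x‖ * ‖y‖ := by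
  have := norm_inner_sq_le (B := B) x y
  rw [← IsHilbertModule.norm_sq_eq, ← IsHilbertModule.norm_sq_eq, ← mul_pow] at this
  exact le_of_sq_le_sq this (by positivity)

theorem norm_rsmul_le (x : X) (b : B) : ‖x <• b‖ ≤ ‖x‖ * ‖b‖ := by
  refine le_of_sq_le_sq ?_ (by positivity)
  rw [IsHilbertModule.norm_sq_eq (B := B), inner_rsmul_left, inner_rsmul_right, mul_pow,
    IsHilbertModule.norm_sq_eq (B := B)]
  calc _ ≤ ‖star b‖ * (‖inner B x x‖ * ‖b‖) :=
        (norm_mul_le _ _).trans (by gcongr; exact norm_mul_le _ _)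
    _ = _ := by rw [norm_star]; ring

theorem norm_lsmul_le [SMul A X] [IsAdjointableAction A B X] (a : A) (x : X) :
    ‖a • x‖ ≤ ‖a‖ * ‖x‖ := by
  refine le_of_sq_le_sq ?_ (by positivity)
  rw [mul_pow, IsHilbertModule.norm_sq_eq (B := B), IsHilbertModule.norm_sq_eq (B := B) x]
  exact norm_inner_lsmul_le a x

/-- Two elements of a Hilbert module with the same inner products agree. -/
theorem ext_inner {x y : X} (h : ∀ z, inner B z x = inner B z y) : x = y := by
  rw [← sub_eq_zero]
  apply IsHilbertModule.inner_self_eq_zero (B := B)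
  rw [inner_sub_right, h, sub_self]

end Hilbert

end Basic

/-! ### The internal tensor product -/

section Gram

attribute [local instance] CStarAlgebra.spectralOrder CStarAlgebra.spectralOrderedRing

variable {B C V Y : Type*} [NonUnitalCStarAlgebra B] [NonUnitalCStarAlgebra C]
  [AddCommGroup V] [Module ℂ V] [SMul Bᵐᵒᵖ V] [Inner B V] [IsPreHilbertModule B V]

theorem eq_zero_of_star_mul_self_add {b c : B} (hb : ∃ d, b = star d * d)
    (hc : ∃ d, c = star d * d) (h : b + c = 0) : b = 0 := by
  have := norm_le_norm_add hb hc
  rw [h, norm_zero] at this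
  exact norm_le_zero_iff.mp this

theorem exists_star_mul_sum {ι : Type*} (s : Finset ι) (f : ι → B)
    (h : ∀ i ∈ s, ∃ d, f i = star d * d) : ∃ d, ∑ i ∈ s, f i = star d * d := by
  rw [← CStarAlgebra.nonneg_iff_eq_star_mul_self]
  exact Finset.sum_nonneg fun i hi => CStarAlgebra.nonneg_iff_eq_star_mul_self.mpr (h i hi)

theorem exists_negPart {G : B} (hG : IsSelfAdjoint G) : ∃ N S : B, star N = N ∧
    N * N * N = star S * S ∧ N * G * N = - (N * N * N) ∧ (N = 0 → ∃ M, G = star M * M) := by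
  have hN : star (G⁻) = G⁻ := (CFC.negPart_nonneg G).isSelfAdjoint
  have h1 : G⁻ * G * G⁻ = - (G⁻ * G⁻ * G⁻) := by
    have h : G * G⁻ = (G⁺ - G⁻) * G⁻ := congrArg (· * G⁻) (CFC.posPart_sub_negPart G hG).symm
    rw [mul_assoc, h, sub_mul, CFC.posPart_mul_negPart, zero_sub, mul_neg, mul_assoc]
  have h2 : ∃ S : B, G⁻ * G⁻ * G⁻ = star S * S := by
    rw [← CStarAlgebra.nonneg_iff_eq_star_mul_self]
    have := star_left_conjugate_nonneg (CFC.negPart_nonneg G) (G⁻)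
    rwa [hN] at this
  obtain ⟨S, hS⟩ := h2
  refine ⟨G⁻, S, hN, hS, h1, fun h => ?_⟩
  rw [← CStarAlgebra.nonneg_iff_eq_star_mul_self, ← CFC.posPart_sub_negPart G hG, h, sub_zero]
  exact CFC.posPart_nonneg G

/-- Gram matrices are positive. -/
theorem gram_eq {n : ℕ} (x : Fin n → V) : ∃ M : Fin n → Fin n → B, ∀ i j,
    inner B (x i) (x j) = ∑ k, star (M k i) * M k j := by
  let G : CStarMatrix (Fin n) (Fin n) B := CStarMatrix.ofMatrix fun i j => inner B (x i) (x j)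
  have hG : IsSelfAdjoint G := by
    ext i j
    exact star_inner _ _
  obtain ⟨N, S, hN, hS, h1, hpos⟩ := exists_negPart hG
  have hdiag : ∀ j, (∑ k, star (S k j) * S k j) = 0 := by
    intro j
    refine eq_zero_of_star_mul_self_add
      (c := inner B (∑ k, x k <• N k j) (∑ k, x k <• N k j))
      (exists_star_mul_sum _ _ fun k _ => ⟨_, rfl⟩) (inner_self_nonneg _) ?_
    have e1 : (∑ k, star (S k j) * S k j) = (star S * S) j j := rfl
    have e2 : inner B (∑ k, x k <• N k j) (∑ k, x k <• N k j)
        = (star N * G * N) j j := by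
      simp only [inner_sum_left, inner_sum_right, inner_rsmul_left, inner_rsmul_right,
        CStarMatrix.mul_apply, Finset.sum_mul]
      refine Finset.sum_congr rfl fun k _ => Finset.sum_congr rfl fun l _ => ?_
      rfl
    rw [e1, e2, hN, h1, hS]
    exact add_neg_cancel _
  have hS0 : S = 0 := by
    ext k j
    have h3 := hdiag j
    rw [← Finset.add_sum_erase _ _ (Finset.mem_univ k)] at h3
    have h4 := eq_zero_of_star_mul_self_add ⟨_, rfl⟩
      (exists_star_mul_sum _ _ fun k _ => ⟨_, rfl⟩) h3
    exact CStarRing.star_mul_self_eq_zero_iff _ |>.mp h4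
  have h5 : N * N * N = 0 := by rw [hS, hS0, mul_zero]
  have h6 : N * N = 0 := by
    rw [← CStarRing.star_mul_self_eq_zero_iff, star_mul, hN, ← mul_assoc, h5, zero_mul]
  have h7 : N = 0 := by
    rw [← CStarRing.star_mul_self_eq_zero_iff, hN, h6]
  obtain ⟨M, hM⟩ := hpos h7
  exact ⟨M, fun i j => congrFun (congrFun hM i) j⟩

end Gram

section Tensor

variable (B C X Y : Type*) [NonUnitalCStarAlgebra B] [NonUnitalCStarAlgebra C]
  [NormedAddCommGroup X] [NormedSpace ℂ X] [SMul Bᵐᵒᵖ X] [Inner B X]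
  [NormedAddCommGroup Y] [NormedSpace ℂ Y] [SMul B Y] [SMul Cᵐᵒᵖ Y] [Inner C Y]
  [hX : IsHilbertModule B X] [hY : IsRightHilbertBimodule B C Y]

/-- The algebraic tensor product `X ⊙ Y` over `ℂ` of a Hilbert `B`-module `X` and a right-Hilbert
`B`–`C` bimodule `Y`, to be given the semi-inner product of the internal tensor product. -/
@[nolint unusedArguments]
def AlgTensor (B C X Y : Type*) [NonUnitalCStarAlgebra B] [NonUnitalCStarAlgebra C]
    [NormedAddCommGroup X] [NormedSpace ℂ X] [SMul Bᵐᵒᵖ X] [Inner B X]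
    [NormedAddCommGroup Y] [NormedSpace ℂ Y] [SMul B Y] [SMul Cᵐᵒᵖ Y] [Inner C Y]
    [IsHilbertModule B X] [IsRightHilbertBimodule B C Y] : Type _ := X ⊗[ℂ] Y

namespace AlgTensor

instance : AddCommGroup (AlgTensor B C X Y) := inferInstanceAs (AddCommGroup (X ⊗[ℂ] Y))

instance : Module ℂ (AlgTensor B C X Y) := inferInstanceAs (Module ℂ (X ⊗[ℂ] Y))

/-- The elementary tensor `x ⊗ y` in the algebraic tensor product. -/
def tmul (x : X) (y : Y) : AlgTensor B C X Y := x ⊗ₜ[ℂ] y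

/-- The form `⟨x ⊗ y, x' ⊗ y'⟩ = ⟨y, ⟨x, x'⟩ • y'⟩` on the algebraic tensor product. -/
def form : AlgTensor B C X Y →ₗ⋆[ℂ] AlgTensor B C X Y →ₗ[ℂ] C :=
  (TensorProduct.lift <| LinearMap.mk₂'ₛₗ (starRingEnd ℂ) (starRingEnd ℂ)
    (fun (x : X) (y : Y) => (TensorProduct.lift <| LinearMap.mk₂ ℂ
      (fun (x' : X) (y' : Y) => inner C y (inner B x x' • y'))
      (fun x₁ x₂ y' => by
        rw [inner_add_right, hY.add_lsmul, inner_add_right])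
      (fun r x' y' => by
        rw [inner_smul_right, hY.smul_lsmul, inner_smul_right])
      (fun x' y₁ y₂ => by
        rw [hY.lsmul_add, inner_add_right])
      (fun r x' y' => by
        rw [hY.lsmul_smul, inner_smul_right]) : X ⊗[ℂ] Y →ₗ[ℂ] C))
    (fun x₁ x₂ y => TensorProduct.ext' fun x' y' => by
      simp [inner_add_left, inner_add_right, hY.add_lsmul])
    (fun r x y => TensorProduct.ext' fun x' y' => by
      simp [inner_smul_left, inner_smul_right, hY.smul_lsmul])
    (fun x y₁ y₂ => TensorProduct.ext' fun x' y' => by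
      simp [inner_add_left])
    (fun r x y => TensorProduct.ext' fun x' y' => by
      simp [inner_smul_left]) : X ⊗[ℂ] Y →ₗ⋆[ℂ] X ⊗[ℂ] Y →ₗ[ℂ] C)

instance : Inner C (AlgTensor B C X Y) := ⟨fun s t => form B C X Y s t⟩

/-- The right action `(x ⊗ y) <• c = x ⊗ (y <• c)`. -/
instance : SMul Cᵐᵒᵖ (AlgTensor B C X Y) :=
  ⟨fun c => LinearMap.lTensor X (rsmulLin Y c.unop)⟩

/-- The left action `a • (x ⊗ y) = (a • x) ⊗ y`. -/
instance {A : Type*} [NonUnitalCStarAlgebra A] [SMul A X] [IsAdjointableAction A B X] :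
    SMul A (AlgTensor B C X Y) :=
  ⟨fun a => LinearMap.rTensor Y (lsmulLin B X a)⟩

variable {B C X Y}

theorem inner_tmul (x x' : X) (y y' : Y) :
    inner C (tmul B C X Y x y) (tmul B C X Y x' y') = inner C y (inner B x x' • y') := rfl

theorem tmul_rsmul (x : X) (y : Y) (c : C) :
    tmul B C X Y x y <• c = tmul B C X Y x (y <• c) := rfl

theorem lsmul_tmul {A : Type*} [NonUnitalCStarAlgebra A] [SMul A X] [IsAdjointableAction A B X]
    (a : A) (x : X) (y : Y) : a • tmul B C X Y x y = tmul B C X Y (a • x) y := rfl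

theorem ind {p : AlgTensor B C X Y → Prop} (t : AlgTensor B C X Y)
    (h0 : p 0) (ht : ∀ x y, p (tmul B C X Y x y)) (ha : ∀ s t, p s → p t → p (s + t)) : p t :=
  TensorProduct.induction_on t h0 ht ha

theorem exists_sum (t : AlgTensor B C X Y) : ∃ (n : ℕ) (x : Fin n → X) (y : Fin n → Y),
    t = ∑ i, tmul B C X Y (x i) (y i) := by
  induction t using ind with
  | h0 => exact ⟨0, Fin.elim0, Fin.elim0, by simp⟩
  | ht x y => exact ⟨1, fun _ => x, fun _ => y, by simp⟩
  | ha s t hs ht =>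
    obtain ⟨n, x, y, rfl⟩ := hs
    obtain ⟨m, x', y', rfl⟩ := ht
    exact ⟨n + m, Fin.append x x', Fin.append y y', by simp [Fin.sum_univ_add]⟩

theorem rsmul_lin (t : AlgTensor B C X Y) (c : C) :
    t <• c = LinearMap.lTensor X (rsmulLin Y c) t := rfl

theorem form_apply (s t : AlgTensor B C X Y) : inner C s t = form B C X Y s t := rfl

theorem rsmul_add_left (s t : AlgTensor B C X Y) (c : C) : (s + t) <• c = s <• c + t <• c :=
  (LinearMap.lTensor X (rsmulLin Y c)).map_add s t

theorem rsmul_zero_left (c : C) : (0 : AlgTensor B C X Y) <• c = 0 :=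
  (LinearMap.lTensor X (rsmulLin Y c)).map_zero

theorem star_form (s t : AlgTensor B C X Y) : star (inner C s t) = inner C t s := by
  simp only [form_apply]
  induction s using ind with
  | h0 => simp
  | ha s s' hs hs' => simp [hs, hs']
  | ht x y =>
    induction t using ind with
    | h0 => simp
    | ha t t' ht ht' => simp [ht, ht']
    | ht x' y' =>
      rw [← form_apply, ← form_apply, inner_tmul, inner_tmul, star_inner, hY.inner_lsmul_left,
        star_inner]

theorem form_self (t : AlgTensor B C X Y) : ∃ c : C, inner C t t = star c * c := by
  obtain ⟨n, x, y, rfl⟩ := exists_sum t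
  obtain ⟨M, hM⟩ := gram_eq (B := B) x
  have e : inner C (∑ i, tmul B C X Y (x i) (y i)) (∑ i, tmul B C X Y (x i) (y i)) =
      ∑ k, inner C (∑ i, M k i • y i) (∑ i, M k i • y i) := by
    have h1 : ∀ i j, form B C X Y (tmul B C X Y (x i) (y i)) (tmul B C X Y (x j) (y j)) =
        ∑ k, inner C (M k i • y i) (M k j • y j) := by
      intro i j
      rw [← form_apply, inner_tmul, hM]
      have : ∀ b : B, b • y j = ((LinearMap.mk₂ ℂ (fun (b : B) (y : Y) => b • y)
        hY.add_lsmul hY.smul_lsmul hY.lsmul_add (fun r b y => hY.lsmul_smul r b y)).flip (y j)) b :=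
        fun _ => rfl
      rw [this, map_sum, inner_sum_right]
      refine Finset.sum_congr rfl fun k _ => ?_
      rw [← this, hY.mul_lsmul, hY.inner_lsmul_left]
    simp only [form_apply, map_sum, LinearMap.sum_apply, h1, inner_sum_left, inner_sum_right]
    rw [Finset.sum_comm_cycle]
  rw [e]
  exact exists_star_mul_sum _ _ fun k _ => inner_self_nonneg _

instance instPre : IsPreHilbertModule C (AlgTensor B C X Y) where
  add_rsmul s t c := rsmul_add_left s t c
  rsmul_add t c d := by
    induction t using ind with
    | h0 => simp only [rsmul_zero_left, add_zero]
    | ht x y =>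
      simp only [tmul_rsmul, hY.rsmul_add]
      exact TensorProduct.tmul_add x _ _
    | ha s t hs ht => simp only [rsmul_add_left, hs, ht]; abel
  rsmul_mul t c d := by
    induction t using ind with
    | h0 => simp only [rsmul_zero_left]
    | ht x y => simp only [tmul_rsmul, hY.rsmul_mul]
    | ha s t hs ht => simp only [rsmul_add_left, hs, ht]
  smul_rsmul r t c := (LinearMap.lTensor X (rsmulLin Y c)).map_smul r t
  rsmul_smul r t c := by
    induction t using ind with
    | h0 => simp only [rsmul_zero_left, smul_zero]
    | ht x y =>
      simp only [tmul_rsmul, hY.rsmul_smul]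
      exact TensorProduct.tmul_smul r x _
    | ha s t hs ht => simp only [rsmul_add_left, hs, ht, smul_add]
  inner_add_right s := (form B C X Y s).map_add
  inner_smul_right r s := (form B C X Y s).map_smul r
  inner_rsmul_right s t c := by
    induction s using ind with
    | h0 => simp [form_apply]
    | ha s s' hs hs' => simp only [form_apply, map_add, LinearMap.add_apply, add_mul] at *; rw [hs, hs']
    | ht x y =>
      induction t using ind with
      | h0 => rw [rsmul_zero_left]; simp [form_apply]
      | ha t t' ht ht' =>
        rw [rsmul_add_left]; simp only [form_apply, map_add, add_mul] at *; rw [ht, ht']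
      | ht x' y' => rw [tmul_rsmul, inner_tmul, inner_tmul, hY.lsmul_rsmul, inner_rsmul_right]
  star_inner := star_form
  inner_self_nonneg := form_self

instance instAct {A : Type*} [NonUnitalCStarAlgebra A] [SMul A X] [IsAdjointableAction A B X] :
    IsAdjointableAction A C (AlgTensor B C X Y) where
  lsmul_add a := (LinearMap.rTensor Y (lsmulLin B X a)).map_add
  add_lsmul a a' t := by
    have : lsmulLin B X (a + a') = lsmulLin B X a + lsmulLin B X a' :=
      LinearMap.ext fun x => IsAdjointableAction.add_lsmul (B := B) a a' x
    exact (congrArg (fun f => LinearMap.rTensor Y f t) this).trans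
      (congrFun (congrArg DFunLike.coe (LinearMap.rTensor_add Y _ _)) t)
  mul_lsmul a a' t := by
    have : lsmulLin B X (a * a') = lsmulLin B X a ∘ₗ lsmulLin B X a' :=
      LinearMap.ext fun x => IsAdjointableAction.mul_lsmul (B := B) a a' x
    exact (congrArg (fun f => LinearMap.rTensor Y f t) this).trans
      (LinearMap.rTensor_comp_apply Y _ _ t)
  lsmul_smul r a := (LinearMap.rTensor Y (lsmulLin B X a)).map_smul r
  smul_lsmul r a t := by
    have : lsmulLin B X (r • a) = r • lsmulLin B X a :=
      LinearMap.ext fun x => IsAdjointableAction.smul_lsmul (B := B) r a x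
    exact (congrArg (fun f => LinearMap.rTensor Y f t) this).trans
      (congrFun (congrArg DFunLike.coe (LinearMap.rTensor_smul Y _ _)) t)
  lsmul_rsmul a t c := by
    have h := LinearMap.rTensor_comp_lTensor (M := X) (N := Y) (lsmulLin B X a) (rsmulLin Y c)
    have h' := LinearMap.lTensor_comp_rTensor (M := X) (N := Y) (lsmulLin B X a) (rsmulLin Y c)
    exact congrFun (congrArg DFunLike.coe (h.trans h'.symm)) t
  inner_lsmul_left a s t := by
    have ladd : ∀ (a : A) (s t : AlgTensor B C X Y), a • (s + t) = a • s + a • t := fun a =>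
      (LinearMap.rTensor Y (lsmulLin B X a)).map_add
    have lzero : ∀ (a : A), a • (0 : AlgTensor B C X Y) = 0 := fun a =>
      (LinearMap.rTensor Y (lsmulLin B X a)).map_zero
    induction s using ind with
    | h0 => rw [lzero]; simp [form_apply]
    | ha s s' hs hs' => rw [ladd, inner_add_left, inner_add_left, hs, hs']
    | ht x y =>
      induction t using ind with
      | h0 => rw [lzero]; simp [form_apply]
      | ha t t' ht ht' => rw [ladd, inner_add_right, inner_add_right, ht, ht']
      | ht x' y' =>
        rw [lsmul_tmul, lsmul_tmul, inner_tmul, inner_tmul, IsAdjointableAction.inner_lsmul_left]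

/-- The seminorm `‖t‖ = ‖⟨t, t⟩‖ ^ (1 / 2)`. -/
instance instNorm : Norm (AlgTensor B C X Y) := ⟨fun t => √‖inner C t t‖⟩

instance instSeminormed : SeminormedAddCommGroup (AlgTensor B C X Y) :=
  SeminormedAddCommGroup.ofCore (𝕜 := ℂ) (seminormCore (B := C))

instance instNormedSpace : NormedSpace ℂ (AlgTensor B C X Y) :=
  { norm_smul_le := fun r t => ((seminormCore (B := C)).norm_smul r t).le }

theorem norm_sq (t : AlgTensor B C X Y) : ‖t‖ ^ 2 = ‖inner C t t‖ :=
  Real.sq_sqrt (norm_nonneg _)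

theorem norm_form_le (s t : AlgTensor B C X Y) : ‖inner C s t‖ ≤ ‖s‖ * ‖t‖ := by
  refine le_of_sq_le_sq ?_ (by positivity)
  rw [mul_pow, norm_sq, norm_sq]
  exact norm_inner_sq_le s t

theorem continuous_form : Continuous fun p : AlgTensor B C X Y × AlgTensor B C X Y =>
    inner C p.1 p.2 := by
  let F := LinearMap.mkContinuous₂ (form B C X Y) 1 fun s t => by
    rw [one_mul]; exact norm_form_le s t
  exact (F.continuous.comp continuous_fst).clm_apply continuous_snd

instance instUniform {A : Type*} [NonUnitalCStarAlgebra A] [SMul A X]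
    [IsAdjointableAction A B X] : UniformContinuousConstSMul A (AlgTensor B C X Y) where
  uniformContinuous_const_smul a := by
    refine (LinearMap.mkContinuous (lsmulLin C (AlgTensor B C X Y) a) ‖a‖ fun t => ?_).uniformContinuous
    refine le_of_sq_le_sq ?_ (by positivity)
    rw [mul_pow, norm_sq, norm_sq]
    exact norm_inner_lsmul_le a t

instance instUniformOp : UniformContinuousConstSMul Cᵐᵒᵖ (AlgTensor B C X Y) where
  uniformContinuous_const_smul c := by
    refine (LinearMap.mkContinuous (rsmulLin (AlgTensor B C X Y) c.unop) ‖c.unop‖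
      fun t => ?_).uniformContinuous
    refine le_of_sq_le_sq ?_ (by positivity)
    rw [mul_pow, norm_sq, norm_sq]
    change ‖inner C (t <• c.unop) (t <• c.unop)‖ ≤ _
    rw [inner_rsmul_left, inner_rsmul_right, sq]
    calc _ ≤ ‖star c.unop‖ * (‖inner C t t‖ * ‖c.unop‖) :=
          (norm_mul_le _ _).trans (by gcongr; exact norm_mul_le _ _)
      _ = _ := by rw [norm_star]; ring

end AlgTensor

/-- The internal (balanced) tensor product `X ⊗_B Y`: the algebraic tensor product modulo the
vectors of length zero, completed. Mathlib's `UniformSpace.Completion` is the Hausdorff completion,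
which does both at once, and it extends the two actions and the inner product by continuity; see
`InternalTensor.lsmul_tmul`, `InternalTensor.tmul_rsmul` and `InternalTensor.inner_tmul`. -/
abbrev InternalTensor (B C X Y : Type*) [NonUnitalCStarAlgebra B] [NonUnitalCStarAlgebra C]
    [NormedAddCommGroup X] [NormedSpace ℂ X] [SMul Bᵐᵒᵖ X] [Inner B X]
    [NormedAddCommGroup Y] [NormedSpace ℂ Y] [SMul B Y] [SMul Cᵐᵒᵖ Y] [Inner C Y]
    [IsHilbertModule B X] [IsRightHilbertBimodule B C Y] : Type _ :=
  UniformSpace.Completion (AlgTensor B C X Y)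

namespace InternalTensor

/-- The elementary tensor `x ⊗ y` in `X ⊗_B Y`. -/
def tmul (x : X) (y : Y) : InternalTensor B C X Y := (AlgTensor.tmul B C X Y x y : _)

variable {B C X Y}

theorem inner_coe (s t : AlgTensor B C X Y) :
    inner C (s : InternalTensor B C X Y) (t : InternalTensor B C X Y) = inner C s t :=
  (UniformSpace.Completion.isDenseInducing_coe.prodMap
    UniformSpace.Completion.isDenseInducing_coe).extend_eq AlgTensor.continuous_form (s, t)

theorem inner_tmul (x x' : X) (y y' : Y) :
    inner C (tmul B C X Y x y) (tmul B C X Y x' y') = inner C y (inner B x x' • y') :=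
  inner_coe _ _

theorem tmul_rsmul (x : X) (y : Y) (c : C) :
    tmul B C X Y x y <• c = tmul B C X Y x (y <• c) :=
  (UniformSpace.Completion.coe_smul _ _).symm

theorem lsmul_tmul {A : Type*} [NonUnitalCStarAlgebra A] [SMul A X] [IsAdjointableAction A B X]
    (a : A) (x : X) (y : Y) : a • tmul B C X Y x y = tmul B C X Y (a • x) y :=
  (UniformSpace.Completion.coe_smul _ _).symm

end InternalTensor

end Tensor

/-! ### Imprimitivity bimodules and the linking algebra -/

/-- Data of an `A`-valued form on a left `A`-module, written `LeftInner.lin A x y`. -/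
class LeftInner (A X : Type*) where
  /-- the `A`-valued form, to be linear in its first variable -/
  lin (A) : X → X → A

open LeftInner (lin)

/-- An `A`–`B` imprimitivity bimodule: a right-Hilbert `A`–`B` bimodule that is also a full left
Hilbert `A`-module, the two structures being compatible. -/
class IsImprimitivityBimodule (A B X : Type*) [NonUnitalCStarAlgebra A] [NonUnitalCStarAlgebra B]
    [NormedAddCommGroup X] [NormedSpace ℂ X] [SMul A X] [SMul Bᵐᵒᵖ X] [LeftInner A X]
    [Inner B X] : Prop extends IsRightHilbertBimodule A B X where
  lin_add_left (x y z : X) : lin A (x + y) z = lin A x z + lin A y z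
  lin_smul_left (r : ℂ) (x y : X) : lin A (r • x) y = r • lin A x y
  lin_lsmul_left (a : A) (x y : X) : lin A (a • x) y = a * lin A x y
  star_lin (x y : X) : star (lin A x y) = lin A y x
  lin_self_nonneg (x : X) : ∃ c : A, lin A x x = star c * c
  lin_self_eq_zero (x : X) : lin A x x = 0 → x = 0
  /-- completeness in the norm `‖lin A x x‖ ^ (1 / 2)` -/
  left_complete (u : ℕ → X) :
    (∀ ε > 0, ∃ N, ∀ m ≥ N, ∀ n ≥ N, √‖lin A (u m - u n) (u m - u n)‖ < ε) →
      ∃ x, ∀ ε > 0, ∃ N, ∀ n ≥ N, √‖lin A (u n - x) (u n - x)‖ < ε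
  left_full : Dense (Submodule.span ℂ {a : A | ∃ x y : X, a = lin A x y} : Set A)
  lin_lsmul (x y z : X) : lin A x y • z = x <• inner B y z
  lin_rsmul_left (x y : X) (b : B) : lin A (x <• b) y = lin A x (y <• star b)

section Adjointable

variable (B X : Type*) [NonUnitalCStarAlgebra B] [NormedAddCommGroup X] [NormedSpace ℂ X]
  [SMul Bᵐᵒᵖ X] [Inner B X] [hX : IsHilbertModule B X]

/-- `S` is an adjoint of `T`. -/
def IsAdj (T S : X →L[ℂ] X) : Prop := ∀ x y, inner B (T x) y = inner B x (S y)

variable {B X}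

theorem IsAdj.symm {T S : X →L[ℂ] X} (h : IsAdj B X T S) : IsAdj B X S T := fun x y => by
  rw [← star_inner, ← h, star_inner]

theorem IsAdj.unique {T S S' : X →L[ℂ] X} (h : IsAdj B X T S) (h' : IsAdj B X T S') : S = S' :=
  ContinuousLinearMap.ext fun y => ext_inner (B := B) fun x => (h x y).symm.trans (h' x y)

theorem IsAdj.mul {T S T' S' : X →L[ℂ] X} (h : IsAdj B X T S) (h' : IsAdj B X T' S') :
    IsAdj B X (T * T') (S' * S) := fun x y => (h (T' x) y).trans (h' x (S y))

theorem IsAdj.add {T S T' S' : X →L[ℂ] X} (h : IsAdj B X T S) (h' : IsAdj B X T' S') :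
    IsAdj B X (T + T') (S + S') := fun x y => by
  change inner B (T x + T' x) y = inner B x (S y + S' y)
  rw [inner_add_left, inner_add_right, h, h']

theorem IsAdj.smul {T S : X →L[ℂ] X} (h : IsAdj B X T S) (r : ℂ) :
    IsAdj B X (r • T) (conj r • S) := fun x y => by
  change inner B (r • T x) y = inner B x (conj r • S y)
  rw [inner_smul_left, inner_smul_right, h]

theorem IsAdj.norm_sq_le {T S : X →L[ℂ] X} (h : IsAdj B X T S) : ‖T‖ ^ 2 ≤ ‖S * T‖ := by
  have : ‖T‖ ≤ √‖S * T‖ := by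
    refine ContinuousLinearMap.opNorm_le_bound _ (Real.sqrt_nonneg _) fun x => ?_
    refine le_of_sq_le_sq ?_ (by positivity)
    rw [mul_pow, Real.sq_sqrt (norm_nonneg _), IsHilbertModule.norm_sq_eq (B := B), h]
    calc _ ≤ ‖x‖ * ‖(S * T) x‖ := norm_inner_le (B := B) _ _
      _ ≤ ‖x‖ * (‖S * T‖ * ‖x‖) := by gcongr; exact (S * T).le_opNorm x
      _ = _ := by ring
  calc ‖T‖ ^ 2 ≤ √‖S * T‖ ^ 2 := by gcongr
    _ = _ := Real.sq_sqrt (norm_nonneg _)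

theorem IsAdj.norm_le {T S : X →L[ℂ] X} (h : IsAdj B X T S) : ‖T‖ ≤ ‖S‖ := by
  have h1 := h.norm_sq_le.trans (norm_mul_le S T)
  by_contra! h2
  nlinarith [norm_nonneg S, norm_nonneg T]

variable (B X) in
/-- The algebra of adjointable operators on a Hilbert module. -/
def Adjointable : Subalgebra ℂ (X →L[ℂ] X) where
  carrier := {T | ∃ S, IsAdj B X T S}
  mul_mem' := fun ⟨_, h⟩ ⟨_, h'⟩ => ⟨_, h.mul h'⟩
  add_mem' := fun ⟨_, h⟩ ⟨_, h'⟩ => ⟨_, h.add h'⟩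
  algebraMap_mem' r := ⟨conj r • 1, by
    rw [Algebra.algebraMap_eq_smul_one]
    exact IsAdj.smul (fun _ _ => rfl) r⟩

namespace Adjointable

theorem isClosed : IsClosed (Adjointable B X : Set (X →L[ℂ] X)) := by
  have := hX.complete
  refine isClosed_of_closure_subset fun T hT => ?_
  obtain ⟨u, hu, hT⟩ := mem_closure_iff_seq_limit.mp hT
  choose S hS using hu
  have hc : CauchySeq S := by
    have hle : ∀ n m, dist (S n) (S m) ≤ dist (u n) (u m) := fun n m => by
      rw [dist_eq_norm, dist_eq_norm, sub_eq_add_neg, sub_eq_add_neg]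
      have h : IsAdj B X (u n + -u m) (S n + -S m) := by
        have := (hS n).add ((hS m).smul (-1))
        simpa using this
      exact h.symm.norm_le
    rw [Metric.cauchySeq_iff]
    intro ε hε
    obtain ⟨N, hN⟩ := Metric.cauchySeq_iff.mp hT.cauchySeq ε hε
    exact ⟨N, fun m hm n hn => (hle m n).trans_lt (hN m hm n hn)⟩
  obtain ⟨S', hS'⟩ := cauchySeq_tendsto_of_complete hc
  refine ⟨S', fun x y => ?_⟩
  have hcl : ∀ z : X, Continuous fun w => inner B z w := fun z =>
    (LinearMap.mkContinuous (innerRight B z) ‖z‖ fun w => norm_inner_le z w).continuous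
  have h1 : Filter.Tendsto (fun n => inner B x (S n y)) Filter.atTop (nhds (inner B x (S' y))) :=
    ((hcl x).tendsto _).comp ((ContinuousLinearMap.apply ℂ X y).continuous.tendsto S' |>.comp hS')
  have h2 : Filter.Tendsto (fun n => star (inner B y (u n x))) Filter.atTop
      (nhds (star (inner B y (T x)))) :=
    (continuous_star.tendsto _).comp (((hcl y).tendsto _).comp
      ((ContinuousLinearMap.apply ℂ X x).continuous.tendsto T |>.comp hT))
  rw [star_inner] at h2
  refine tendsto_nhds_unique h2 (h1.congr fun n => ?_)
  rw [star_inner]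
  exact (hS n x y).symm

instance : Star (Adjointable B X) := ⟨fun T => ⟨T.2.choose, T.1, T.2.choose_spec.symm⟩⟩

theorem isAdj_star (T : Adjointable B X) : IsAdj B X T.1 (star T).1 := T.2.choose_spec

theorem star_eq {T : Adjointable B X} {S : X →L[ℂ] X} (h : IsAdj B X T.1 S) : (star T).1 = S :=
  (isAdj_star T).unique h

instance : StarRing (Adjointable B X) where
  star_involutive T := Subtype.ext (star_eq (isAdj_star T).symm)
  star_mul S T := Subtype.ext (star_eq ((isAdj_star S).mul (isAdj_star T)))
  star_add S T := Subtype.ext (star_eq ((isAdj_star S).add (isAdj_star T)))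

instance : CStarAlgebra (Adjointable B X) where
  toCompleteSpace := by
    have := hX.complete
    exact isClosed.completeSpace_coe
  norm_mul_self_le T := by
    rw [← sq]
    exact (isAdj_star T).norm_sq_le
  star_smul r T := Subtype.ext (star_eq ((isAdj_star T).smul r))

end Adjointable

variable {A : Type*} [NonUnitalCStarAlgebra A] [SMul A X] [IsAdjointableAction A B X]

variable (B X) in
/-- The left action as bounded operators. -/
def lsmulCLM (a : A) : X →L[ℂ] X :=
  LinearMap.mkContinuous (lsmulLin B X a) ‖a‖ fun x => norm_lsmul_le (B := B) a x

theorem isAdj_lsmul (a : A) : IsAdj B X (lsmulCLM B X a) (lsmulCLM B X (star a)) :=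
  fun x y => IsAdjointableAction.inner_lsmul_left a x y

variable (B X A) in
/-- A left action by adjointable operators as a homomorphism `A → 𝓛(X)`. -/
def actionHom : A →⋆ₙₐ[ℂ] Adjointable B X where
  toFun a := ⟨lsmulCLM B X a, _, isAdj_lsmul a⟩
  map_smul' r a := Subtype.ext <| ContinuousLinearMap.ext fun x =>
    IsAdjointableAction.smul_lsmul (B := B) r a x
  map_zero' := Subtype.ext <| ContinuousLinearMap.ext fun x => by
    change (0 : A) • x = 0
    have := IsAdjointableAction.smul_lsmul (B := B) (0 : ℂ) (0 : A) x
    rwa [zero_smul, zero_smul] at this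
  map_add' a a' := Subtype.ext <| ContinuousLinearMap.ext fun x =>
    IsAdjointableAction.add_lsmul (B := B) a a' x
  map_mul' a a' := Subtype.ext <| ContinuousLinearMap.ext fun x =>
    IsAdjointableAction.mul_lsmul (B := B) a a' x
  map_star' a := Subtype.ext (Adjointable.star_eq (isAdj_lsmul a)).symm

end Adjointable

section Imprim

variable {A B X : Type*} [NonUnitalCStarAlgebra A] [NonUnitalCStarAlgebra B]
    [NormedAddCommGroup X] [NormedSpace ℂ X] [SMul A X] [SMul Bᵐᵒᵖ X] [LeftInner A X]
    [Inner B X]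

theorem lin_smul_right (hX : IsImprimitivityBimodule A B X) (r : ℂ) (x y : X) : lin A x (r • y) = conj r • lin A x y := by
  rw [← hX.star_lin, hX.lin_smul_left, star_smul, hX.star_lin]; rfl

theorem lin_add_right (hX : IsImprimitivityBimodule A B X) (x y z : X) : lin A x (y + z) = lin A x y + lin A x z := by
  rw [← hX.star_lin, hX.lin_add_left, star_add, hX.star_lin, hX.star_lin]

theorem lin_lsmul_right (hX : IsImprimitivityBimodule A B X) (a : A) (x y : X) : lin A x (a • y) = lin A x y * star a := by
  rw [← hX.star_lin, hX.lin_lsmul_left, star_mul, hX.star_lin]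

theorem lin_rsmul_right (hX : IsImprimitivityBimodule A B X) (x y : X) (b : B) : lin A x (y <• b) = lin A (x <• star b) y := by
  rw [hX.lin_rsmul_left, star_star]

theorem lin_zero_left (hX : IsImprimitivityBimodule A B X) (y : X) : lin A 0 y = 0 := by
  have := hX.lin_smul_left 0 0 y
  rwa [zero_smul, zero_smul] at this

theorem lin_zero_right (hX : IsImprimitivityBimodule A B X) (y : X) : lin A y 0 = 0 := by
  rw [← hX.star_lin, lin_zero_left hX, star_zero]

theorem eq_zero_of_lsmul_eq_zero (hX : IsImprimitivityBimodule A B X) {a : A} (h : ∀ x : X, a • x = 0) : a = 0 := by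
  have h1 : ∀ c : A, a * c = 0 := by
    intro c
    have hs : ∀ c ∈ Submodule.span ℂ {a : A | ∃ x y : X, a = lin A x y}, a * c = 0 := by
      intro c hc
      induction hc using Submodule.span_induction with
      | mem c hc =>
        obtain ⟨x, y, rfl⟩ := hc
        rw [← hX.lin_lsmul_left, h, lin_zero_left hX]
      | zero => exact mul_zero a
      | add c d _ _ hc hd => rw [mul_add, hc, hd, add_zero]
      | smul r c _ hc => rw [mul_smul_comm, hc, smul_zero]
    have hcl : IsClosed {c : A | a * c = 0} := isClosed_eq (by fun_prop) continuous_const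
    exact hcl.closure_subset_iff.mpr hs (hX.left_full c)
  exact CStarRing.mul_star_self_eq_zero_iff a |>.mp (h1 _)

/-- The left action of an imprimitivity bimodule is isometric. -/
theorem norm_le_of_lsmul (hX : IsImprimitivityBimodule A B X) (a : A) {k : ℝ} (hk : 0 ≤ k) (h : ∀ x : X, ‖a • x‖ ≤ k * ‖x‖) :
    ‖a‖ ≤ k := by
  have hinj : Function.Injective (actionHom B X A) := by
    rw [injective_iff_map_eq_zero]
    intro a ha
    refine eq_zero_of_lsmul_eq_zero hX fun x => ?_
    exact congrFun (congrArg (fun T : Adjointable B X => (T.1 : X → X)) ha) x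
  rw [← NonUnitalStarAlgHom.norm_map (actionHom B X A) hinj a]
  exact ContinuousLinearMap.opNorm_le_bound _ hk h

end Imprim

section Column

attribute [local instance] CStarAlgebra.spectralOrder CStarAlgebra.spectralOrderedRing

/-- The Hilbert `B`-module direct sum `X ⊕ B`. -/
@[ext]
structure Column (B X : Type*) where
  /-- the component in `X` -/
  x : X
  /-- the component in `B` -/
  b : B

namespace Column

variable {B X : Type*} [NonUnitalCStarAlgebra B] [NormedAddCommGroup X] [NormedSpace ℂ X]
  [SMul Bᵐᵒᵖ X] [Inner B X]

/-- The underlying pair. -/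
def toProd : Column B X ≃ X × B := ⟨fun v => (v.x, v.b), fun p => ⟨p.1, p.2⟩, fun _ => rfl, fun _ => rfl⟩

instance : AddCommGroup (Column B X) := toProd.addCommGroup

instance : Module ℂ (Column B X) := toProd.module ℂ

instance : SMul Bᵐᵒᵖ (Column B X) := ⟨fun c v => ⟨v.x <• c.unop, v.b * c.unop⟩⟩

instance : Inner B (Column B X) := ⟨fun v w => inner B v.x w.x + star v.b * w.b⟩

theorem add_x (v w : Column B X) : (v + w).x = v.x + w.x := rfl
theorem add_b (v w : Column B X) : (v + w).b = v.b + w.b := rfl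
theorem smul_x (r : ℂ) (v : Column B X) : (r • v).x = r • v.x := rfl
theorem smul_b (r : ℂ) (v : Column B X) : (r • v).b = r • v.b := rfl
theorem rsmul_x (v : Column B X) (c : B) : (v <• c).x = v.x <• c := rfl
theorem rsmul_b (v : Column B X) (c : B) : (v <• c).b = v.b * c := rfl
theorem inner_def (v w : Column B X) : inner B v w = inner B v.x w.x + star v.b * w.b := rfl

variable [hX : IsHilbertModule B X]

instance instPre : IsPreHilbertModule B (Column B X) where
  add_rsmul v w c := Column.ext (hX.add_rsmul _ _ _) (add_mul _ _ _)
  rsmul_add v c d := Column.ext (hX.rsmul_add _ _ _) (mul_add _ _ _)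
  rsmul_mul v c d := Column.ext (hX.rsmul_mul _ _ _) (mul_assoc _ _ _).symm
  smul_rsmul r v c := Column.ext (hX.smul_rsmul _ _ _) (smul_mul_assoc _ _ _)
  rsmul_smul r v c := Column.ext (hX.rsmul_smul _ _ _) (mul_smul_comm _ _ _)
  inner_add_right u v w := by
    simp only [inner_def, add_x, add_b, inner_add_right, mul_add]; abel
  inner_smul_right r v w := by
    simp only [inner_def, smul_x, smul_b, inner_smul_right, mul_smul_comm, smul_add]
  inner_rsmul_right v w c := by
    simp only [inner_def, rsmul_x, rsmul_b, inner_rsmul_right, add_mul, mul_assoc]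
  star_inner v w := by
    simp only [inner_def, star_add, star_mul, star_star, star_inner]
  inner_self_nonneg v := exists_star_mul_add (inner_self_nonneg _) ⟨_, rfl⟩

/-- The norm `‖v‖ = ‖⟨v, v⟩‖ ^ (1 / 2)`. -/
instance instNorm : Norm (Column B X) := ⟨fun v => √‖inner B v v‖⟩

theorem norm_sq (v : Column B X) : ‖v‖ ^ 2 = ‖inner B v v‖ := Real.sq_sqrt (norm_nonneg _)

theorem nonneg (v : Column B X) : 0 ≤ ‖v‖ := Real.sqrt_nonneg _

theorem norm_x_le (v : Column B X) : ‖v.x‖ ≤ ‖v‖ := by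
  refine le_of_sq_le_sq ?_ (nonneg v)
  rw [norm_sq, hX.norm_sq_eq]
  exact norm_le_norm_add (inner_self_nonneg _) ⟨_, rfl⟩

theorem norm_b_le (v : Column B X) : ‖v.b‖ ≤ ‖v‖ := by
  refine le_of_sq_le_sq ?_ (nonneg v)
  rw [norm_sq, inner_def, sq, ← CStarRing.norm_star_mul_self, add_comm]
  exact norm_le_norm_add ⟨_, rfl⟩ (inner_self_nonneg _)

theorem core : NormedSpace.Core ℂ (Column B X) :=
  { seminormCore (B := B) (V := Column B X) with
    norm_eq_zero_iff := fun v => ⟨fun h => Column.ext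
      (norm_le_zero_iff.mp (h ▸ norm_x_le v)) (norm_le_zero_iff.mp (h ▸ norm_b_le v)), fun h => by
      change √‖inner B v v‖ = 0
      rw [h, inner_zero_right, norm_zero, Real.sqrt_zero]⟩ }

instance instNormed : NormedAddCommGroup (Column B X) := NormedAddCommGroup.ofCore core

instance instNormedSpace : NormedSpace ℂ (Column B X) := NormedSpace.ofCore core

theorem norm_x (x : X) : ‖(⟨x, 0⟩ : Column B X)‖ = ‖x‖ := by
  have : ‖(⟨x, 0⟩ : Column B X)‖ ^ 2 = ‖x‖ ^ 2 := by
    rw [norm_sq, inner_def, mul_zero, add_zero, hX.norm_sq_eq]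
  exact (sq_eq_sq₀ (nonneg _) (norm_nonneg _)).mp this

theorem norm_b (b : B) : ‖(⟨0, b⟩ : Column B X)‖ = ‖b‖ := by
  have : ‖(⟨0, b⟩ : Column B X)‖ ^ 2 = ‖b‖ ^ 2 := by
    rw [norm_sq, inner_def, inner_zero_right, zero_add, CStarRing.norm_star_mul_self, sq]
  exact (sq_eq_sq₀ (nonneg _) (norm_nonneg _)).mp this

theorem norm_le (v : Column B X) : ‖v‖ ≤ ‖v.x‖ + ‖v.b‖ := by
  have : v = ⟨v.x, 0⟩ + ⟨0, v.b⟩ := Column.ext (add_zero _).symm (zero_add _).symm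
  calc ‖v‖ = ‖(⟨v.x, 0⟩ + ⟨0, v.b⟩ : Column B X)‖ := by rw [← this]
    _ ≤ _ := norm_add_le _ _
    _ = _ := by rw [norm_x, norm_b]

end Column

end Column

/-- The linking algebra `L(X)` of an `A`–`B` imprimitivity bimodule: matrices `(a x; z~ b)`, where
`z~` is `z` regarded as an element of the conjugate (reverse) `B`–`A` bimodule of `X`, in which
`r • z~ = (conj r • z)~`, `z~ <• a = (star a • z)~` and `b • z~ = (z <• star b)~`. -/
@[ext]
structure Linking (A B X : Type*) [NonUnitalCStarAlgebra A] [NonUnitalCStarAlgebra B]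
    [NormedAddCommGroup X] [NormedSpace ℂ X] [SMul A X] [SMul Bᵐᵒᵖ X] [LeftInner A X]
    [Inner B X] [IsImprimitivityBimodule A B X] where
  /-- upper left entry -/
  a : A
  /-- upper right entry -/
  x : X
  /-- lower left entry, an element of the conjugate bimodule -/
  z : X
  /-- lower right entry -/
  b : B

namespace Linking

variable {A B X : Type*} [NonUnitalCStarAlgebra A] [NonUnitalCStarAlgebra B]
    [NormedAddCommGroup X] [NormedSpace ℂ X] [SMul A X] [SMul Bᵐᵒᵖ X] [LeftInner A X]
    [Inner B X] [hX : IsImprimitivityBimodule A B X]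

instance : Add (Linking A B X) := ⟨fun m n => ⟨m.a + n.a, m.x + n.x, m.z + n.z, m.b + n.b⟩⟩

instance : Zero (Linking A B X) := ⟨⟨0, 0, 0, 0⟩⟩

instance : Neg (Linking A B X) := ⟨fun m => ⟨-m.a, -m.x, -m.z, -m.b⟩⟩

instance : Sub (Linking A B X) := ⟨fun m n => ⟨m.a - n.a, m.x - n.x, m.z - n.z, m.b - n.b⟩⟩

instance : AddCommGroup (Linking A B X) where
  nsmul := nsmulRec
  zsmul := zsmulRec
  add_assoc m n k := Linking.ext (add_assoc _ _ _) (add_assoc _ _ _) (add_assoc _ _ _)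
    (add_assoc _ _ _)
  zero_add m := Linking.ext (zero_add _) (zero_add _) (zero_add _) (zero_add _)
  add_zero m := Linking.ext (add_zero _) (add_zero _) (add_zero _) (add_zero _)
  neg_add_cancel m := Linking.ext (neg_add_cancel _) (neg_add_cancel _) (neg_add_cancel _)
    (neg_add_cancel _)
  add_comm m n := Linking.ext (add_comm _ _) (add_comm _ _) (add_comm _ _) (add_comm _ _)
  sub_eq_add_neg m n := Linking.ext (sub_eq_add_neg _ _) (sub_eq_add_neg _ _) (sub_eq_add_neg _ _)
    (sub_eq_add_neg _ _)

instance : Module ℂ (Linking A B X) where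
  smul r m := ⟨r • m.a, r • m.x, conj r • m.z, r • m.b⟩
  one_smul m := Linking.ext (one_smul _ _) (one_smul _ _)
    ((congrArg (· • m.z) (map_one (starRingEnd ℂ))).trans (one_smul _ _)) (one_smul _ _)
  mul_smul r s m := Linking.ext (mul_smul _ _ _) (mul_smul _ _ _)
    ((congrArg (· • m.z) (map_mul (starRingEnd ℂ) r s)).trans (mul_smul _ _ _)) (mul_smul _ _ _)
  smul_zero r := Linking.ext (smul_zero _) (smul_zero _) (smul_zero _) (smul_zero _)
  smul_add r m n := Linking.ext (smul_add _ _ _) (smul_add _ _ _) (smul_add _ _ _) (smul_add _ _ _)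
  add_smul r s m := Linking.ext (add_smul _ _ _) (add_smul _ _ _)
    ((congrArg (· • m.z) (map_add (starRingEnd ℂ) r s)).trans (add_smul _ _ _)) (add_smul _ _ _)
  zero_smul m := Linking.ext (zero_smul _ _) (zero_smul _ _)
    ((congrArg (· • m.z) (map_zero (starRingEnd ℂ))).trans (zero_smul _ _)) (zero_smul _ _)

instance : Mul (Linking A B X) where
  mul m n := ⟨m.a * n.a + lin A m.x n.z, m.a • n.x + m.x <• n.b,
    star n.a • m.z + n.z <• star m.b, inner B m.z n.x + m.b * n.b⟩

instance : Star (Linking A B X) where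
  star m := ⟨star m.a, m.z, m.x, star m.b⟩

theorem add_a (m n : Linking A B X) : (m + n).a = m.a + n.a := rfl
theorem add_x (m n : Linking A B X) : (m + n).x = m.x + n.x := rfl
theorem add_z (m n : Linking A B X) : (m + n).z = m.z + n.z := rfl
theorem add_b (m n : Linking A B X) : (m + n).b = m.b + n.b := rfl
theorem sub_a (m n : Linking A B X) : (m - n).a = m.a - n.a := rfl
theorem sub_x (m n : Linking A B X) : (m - n).x = m.x - n.x := rfl
theorem sub_z (m n : Linking A B X) : (m - n).z = m.z - n.z := rfl
theorem sub_b (m n : Linking A B X) : (m - n).b = m.b - n.b := rfl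
theorem smul_a (r : ℂ) (m : Linking A B X) : (r • m).a = r • m.a := rfl
theorem smul_x (r : ℂ) (m : Linking A B X) : (r • m).x = r • m.x := rfl
theorem smul_z (r : ℂ) (m : Linking A B X) : (r • m).z = conj r • m.z := rfl
theorem smul_b (r : ℂ) (m : Linking A B X) : (r • m).b = r • m.b := rfl
theorem zero_a : (0 : Linking A B X).a = 0 := rfl
theorem zero_x : (0 : Linking A B X).x = 0 := rfl
theorem zero_z : (0 : Linking A B X).z = 0 := rfl
theorem zero_b : (0 : Linking A B X).b = 0 := rfl
theorem mul_a (m n : Linking A B X) : (m * n).a = m.a * n.a + lin A m.x n.z := rfl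
theorem mul_x (m n : Linking A B X) : (m * n).x = m.a • n.x + m.x <• n.b := rfl
theorem mul_z (m n : Linking A B X) : (m * n).z = star n.a • m.z + n.z <• star m.b := rfl
theorem mul_b (m n : Linking A B X) : (m * n).b = inner B m.z n.x + m.b * n.b := rfl
theorem star_a (m : Linking A B X) : (star m).a = star m.a := rfl
theorem star_x (m : Linking A B X) : (star m).x = m.z := rfl
theorem star_z (m : Linking A B X) : (star m).z = m.x := rfl
theorem star_b (m : Linking A B X) : (star m).b = star m.b := rfl

instance instRing : NonUnitalRing (Linking A B X) where
  left_distrib m n k := by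
    ext
    · simp only [mul_a, add_a, add_z, mul_add, lin_add_right hX]; abel
    · simp only [mul_x, add_x, add_b, hX.lsmul_add, hX.rsmul_add]; abel
    · simp only [mul_z, add_a, add_z, star_add, hX.add_lsmul, hX.add_rsmul]; abel
    · simp only [mul_b, add_x, add_b, mul_add, inner_add_right]; abel
  right_distrib m n k := by
    ext
    · simp only [mul_a, add_a, add_x, add_mul, hX.lin_add_left]; abel
    · simp only [mul_x, add_a, add_x, hX.add_lsmul, hX.add_rsmul]; abel
    · simp only [mul_z, add_z, add_b, star_add, hX.lsmul_add, hX.rsmul_add]; abel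
    · simp only [mul_b, add_z, add_b, add_mul, inner_add_left]; abel
  zero_mul m := by
    ext
    · simp only [mul_a, zero_a, zero_x, zero_mul, lin_zero_left hX, add_zero]
    · simp only [mul_x, zero_a, zero_x, zero_lsmul hX.toIsAdjointableAction, zero_rsmul, add_zero]
    · simp only [mul_z, zero_z, zero_b, star_zero, lsmul_zero hX.toIsAdjointableAction, rsmul_zero hX.toIsPreHilbertModule, add_zero]
    · simp only [mul_b, zero_z, zero_b, zero_mul, inner_zero_left, add_zero]
  mul_zero m := by
    ext
    · simp only [mul_a, zero_a, zero_z, mul_zero, lin_zero_right hX, add_zero]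
    · simp only [mul_x, zero_x, zero_b, lsmul_zero hX.toIsAdjointableAction, rsmul_zero hX.toIsPreHilbertModule, add_zero]
    · simp only [mul_z, zero_a, zero_z, star_zero, zero_lsmul hX.toIsAdjointableAction, zero_rsmul, add_zero]
    · simp only [mul_b, zero_x, zero_b, mul_zero, inner_zero_right, add_zero]
  mul_assoc m n k := by
    ext
    · simp only [mul_a, mul_x, mul_z, add_mul, mul_add, hX.lin_add_left, lin_add_right hX,
        hX.lin_lsmul_left, lin_lsmul_right hX, hX.lin_rsmul_left, star_star, mul_assoc]
      abel
    · simp only [mul_a, mul_x, mul_b, hX.lsmul_add, hX.add_lsmul, hX.rsmul_add, hX.add_rsmul,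
        hX.mul_lsmul, hX.rsmul_mul, hX.lsmul_rsmul, hX.lin_lsmul]
      abel
    · simp only [mul_a, mul_z, mul_b, star_add, star_mul, hX.lsmul_add, hX.add_lsmul, hX.rsmul_add,
        hX.add_rsmul, hX.mul_lsmul, hX.rsmul_mul, hX.lsmul_rsmul, hX.lin_lsmul, hX.star_lin,
        star_inner]
      abel
    · simp only [mul_x, mul_z, mul_b, add_mul, mul_add, inner_add_left, inner_add_right,
        hX.inner_lsmul_left, inner_rsmul_left, inner_rsmul_right, star_star, mul_assoc]
      abel

instance instStarRing : StarRing (Linking A B X) where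
  star_involutive m := Linking.ext (star_star _) rfl rfl (star_star _)
  star_add m n := Linking.ext (star_add _ _) rfl rfl (star_add _ _)
  star_mul m n := by
    ext
    · simp only [star_a, mul_a, star_x, star_z, star_add, star_mul, hX.star_lin]
    · rfl
    · simp only [star_z, mul_z, mul_x, star_a, star_b, star_star]
    · simp only [star_b, mul_b, star_x, star_z, star_add, star_mul, star_inner]

instance : IsScalarTower ℂ (Linking A B X) (Linking A B X) where
  smul_assoc r m n := by
    change r • m * n = r • (m * n)
    ext
    · simp only [mul_a, smul_a, smul_x, smul_mul_assoc, hX.lin_smul_left, smul_add]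
    · simp only [mul_x, smul_a, smul_x, hX.smul_lsmul, hX.smul_rsmul, smul_add]
    · simp only [mul_z, smul_z, smul_b, star_smul, hX.lsmul_smul, hX.rsmul_smul, smul_add]; rfl
    · simp only [mul_b, smul_z, smul_b, inner_smul_left, smul_mul_assoc, smul_add, Complex.conj_conj]

instance : SMulCommClass ℂ (Linking A B X) (Linking A B X) where
  smul_comm r m n := by
    change r • (m * n) = m * r • n
    ext
    · simp only [mul_a, smul_a, smul_z, mul_smul_comm, lin_smul_right hX, smul_add, Complex.conj_conj]
    · simp only [mul_x, smul_b, smul_x, hX.lsmul_smul, hX.rsmul_smul, smul_add]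
    · simp only [mul_z, smul_z, smul_a, star_smul, hX.smul_lsmul, hX.smul_rsmul, smul_add]; rfl
    · simp only [mul_b, smul_x, smul_b, inner_smul_right, mul_smul_comm, smul_add]

instance : StarModule ℂ (Linking A B X) where
  star_smul r m := Linking.ext (star_smul _ _) rfl
    (congrArg (· • m.x) (Complex.conj_conj r).symm) (star_smul _ _)

/-- The action of a matrix on the column `(x; b)`. -/
def mulVec (m : Linking A B X) (v : Column B X) : Column B X :=
  ⟨m.a • v.x + m.x <• v.b, inner B m.z v.x + m.b * v.b⟩

theorem mulVec_le (m : Linking A B X) (v : Column B X) :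
    ‖mulVec m v‖ ≤ (‖m.a‖ + ‖m.x‖ + ‖m.z‖ + ‖m.b‖) * ‖v‖ := by
  have h1 : ‖m.a • v.x‖ ≤ ‖m.a‖ * ‖v‖ := (norm_lsmul_le (B := B) _ _).trans (by
    gcongr; exact Column.norm_x_le v)
  have h2 : ‖m.x <• v.b‖ ≤ ‖m.x‖ * ‖v‖ := (norm_rsmul_le _ _).trans (by
    gcongr; exact Column.norm_b_le v)
  have h3 : ‖inner B m.z v.x‖ ≤ ‖m.z‖ * ‖v‖ := (norm_inner_le _ _).trans (by
    gcongr; exact Column.norm_x_le v)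
  have h4 : ‖m.b * v.b‖ ≤ ‖m.b‖ * ‖v‖ := (norm_mul_le _ _).trans (by
    gcongr; exact Column.norm_b_le v)
  have h5 := Column.norm_le (mulVec m v)
  have h6 := norm_add_le (m.a • v.x) (m.x <• v.b)
  have h7 := norm_add_le (inner B m.z v.x) (m.b * v.b)
  have h8 : (mulVec m v).x = m.a • v.x + m.x <• v.b := rfl
  have h9 : (mulVec m v).b = inner B m.z v.x + m.b * v.b := rfl
  rw [h8, h9] at h5
  linarith

/-- The operator on `X ⊕ B` given by a matrix in the linking algebra. -/
def toCLM (m : Linking A B X) : Column B X →L[ℂ] Column B X :=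
  LinearMap.mkContinuous
    { toFun := mulVec m
      map_add' := fun v w => by
        ext
        · simp only [mulVec, Column.add_x, Column.add_b, hX.lsmul_add, hX.rsmul_add]; abel
        · simp only [mulVec, Column.add_x, Column.add_b, inner_add_right, mul_add]; abel
      map_smul' := fun r v => by
        ext
        · simp only [mulVec, Column.smul_x, Column.smul_b, hX.lsmul_smul, hX.rsmul_smul, smul_add,
            RingHom.id_apply]
        · simp only [mulVec, Column.smul_x, Column.smul_b, inner_smul_right, mul_smul_comm, smul_add,
            RingHom.id_apply] }
    (‖m.a‖ + ‖m.x‖ + ‖m.z‖ + ‖m.b‖) (mulVec_le m)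

theorem toCLM_apply (m : Linking A B X) (v : Column B X) : toCLM m v = mulVec m v := rfl

theorem toCLM_mul (m n : Linking A B X) : toCLM (m * n) = toCLM m * toCLM n := by
  refine ContinuousLinearMap.ext fun v => ?_
  change mulVec (m * n) v = mulVec m (mulVec n v)
  ext
  · simp only [mulVec, mul_a, mul_x, hX.lsmul_add, hX.add_lsmul, hX.rsmul_add, hX.add_rsmul,
        hX.mul_lsmul, hX.rsmul_mul, hX.lsmul_rsmul, hX.lin_lsmul]
    abel
  · simp only [mulVec, mul_z, mul_b, add_mul, mul_add, inner_add_left, inner_add_right,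
        hX.inner_lsmul_left, inner_rsmul_left, inner_rsmul_right, star_star, mul_assoc]
    abel

theorem toCLM_add (m n : Linking A B X) : toCLM (m + n) = toCLM m + toCLM n := by
  refine ContinuousLinearMap.ext fun v => ?_
  change mulVec (m + n) v = mulVec m v + mulVec n v
  ext
  · simp only [mulVec, Column.add_x, add_a, add_x, hX.add_lsmul, hX.add_rsmul]; abel
  · simp only [mulVec, Column.add_b, add_z, add_b, inner_add_left, add_mul]; abel

theorem toCLM_smul (r : ℂ) (m : Linking A B X) : toCLM (r • m) = r • toCLM m := by
  refine ContinuousLinearMap.ext fun v => ?_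
  change mulVec (r • m) v = r • mulVec m v
  ext
  · simp only [mulVec, Column.smul_x, smul_a, smul_x, hX.smul_lsmul, hX.smul_rsmul, smul_add]
  · simp only [mulVec, Column.smul_b, smul_z, smul_b, inner_smul_left, smul_mul_assoc, smul_add,
      Complex.conj_conj]

theorem inner_mulVec (m : Linking A B X) (v w : Column B X) :
    inner B (mulVec m v) w = inner B v (mulVec (star m) w) := by
  simp only [mulVec, Column.inner_def, star_a, star_x, star_z, star_b, inner_add_left,
    inner_add_right, hX.inner_lsmul_left, inner_rsmul_left, inner_rsmul_right, star_add, star_mul,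
    star_inner, mul_add, add_mul, mul_assoc]
  abel

/-- The norm of a matrix is its norm as an operator on the Hilbert module `X ⊕ B`; this is the
unique complete C⋆-norm of the linking algebra. -/
instance instNorm : Norm (Linking A B X) := ⟨fun m => ‖toCLM m‖⟩

theorem norm_def (m : Linking A B X) : ‖m‖ = ‖toCLM m‖ := rfl

theorem norm_mulVec_le (m : Linking A B X) (v : Column B X) : ‖mulVec m v‖ ≤ ‖m‖ * ‖v‖ :=
  (toCLM m).le_opNorm v

theorem norm_le (m : Linking A B X) : ‖m‖ ≤ ‖m.a‖ + ‖m.x‖ + ‖m.z‖ + ‖m.b‖ :=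
  ContinuousLinearMap.opNorm_le_bound _ (by positivity) (mulVec_le m)

theorem norm_a_le (m : Linking A B X) : ‖m.a‖ ≤ ‖m‖ := by
  refine norm_le_of_lsmul hX m.a (norm_nonneg (toCLM m)) fun x => ?_
  have h := (Column.norm_x_le _).trans (norm_mulVec_le m ⟨x, 0⟩)
  rw [Column.norm_x] at h
  have e : (mulVec m ⟨x, 0⟩).x = m.a • x := by
    simp only [mulVec, rsmul_zero hX.toIsPreHilbertModule, add_zero]
  rwa [e] at h

theorem norm_b_le (m : Linking A B X) : ‖m.b‖ ≤ ‖m‖ := by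
  have h : ∀ b : B, ‖m.b * b‖ ≤ ‖m‖ * ‖b‖ := fun b => by
    have h := (Column.norm_b_le _).trans (norm_mulVec_le m ⟨0, b⟩)
    rw [Column.norm_b] at h
    have e : (mulVec m ⟨0, b⟩).b = m.b * b := by
      simp only [mulVec, inner_zero_right, zero_add]
    rwa [e] at h
  have h1 := h (star m.b)
  rw [CStarRing.norm_self_mul_star, norm_star] at h1
  by_contra! h2
  have : 0 ≤ ‖m‖ := norm_nonneg (toCLM m)
  nlinarith

theorem norm_x_le (m : Linking A B X) : ‖m.x‖ ≤ ‖m‖ := by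
  have h : ∀ b : B, ‖m.x <• b‖ ≤ ‖m‖ * ‖b‖ := fun b => by
    have h := (Column.norm_x_le _).trans (norm_mulVec_le m ⟨0, b⟩)
    rw [Column.norm_b] at h
    have e : (mulVec m ⟨0, b⟩).x = m.x <• b := by
      simp only [mulVec, lsmul_zero hX.toIsAdjointableAction, zero_add]
    rwa [e] at h
  have h1 := h (inner B m.x m.x)
  have h2 : ‖inner B (m.x <• inner B m.x m.x) m.x‖ = ‖m.x‖ ^ 2 * ‖m.x‖ ^ 2 := by
    rw [inner_rsmul_left, CStarRing.norm_star_mul_self, hX.norm_sq_eq]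
  have h3 := norm_inner_le (B := B) (m.x <• inner B m.x m.x) m.x
  rw [h2] at h3
  rw [← hX.norm_sq_eq] at h1
  by_contra! h4
  have : 0 ≤ ‖m‖ := norm_nonneg (toCLM m)
  have h5 : 0 < ‖m.x‖ := this.trans_lt h4
  have h6 : ‖m.x‖ ^ 2 * ‖m.x‖ ^ 2 ≤ (‖m‖ * ‖m.x‖ ^ 2) * ‖m.x‖ :=
    h3.trans (mul_le_mul_of_nonneg_right h1 h5.le)
  have h7 : (‖m‖ * ‖m.x‖ ^ 2) * ‖m.x‖ < ‖m.x‖ ^ 2 * ‖m.x‖ ^ 2 := by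
    have : ‖m‖ * ‖m.x‖ ^ 3 < ‖m.x‖ * ‖m.x‖ ^ 3 := by gcongr
    nlinarith
  linarith

theorem norm_z_le (m : Linking A B X) : ‖m.z‖ ≤ ‖m‖ := by
  have h := (Column.norm_b_le _).trans (norm_mulVec_le m ⟨m.z, 0⟩)
  rw [Column.norm_x] at h
  have e : (mulVec m ⟨m.z, 0⟩).b = inner B m.z m.z := by
    simp only [mulVec, mul_zero, add_zero]
  rw [e, ← hX.norm_sq_eq] at h
  by_contra! h3
  have : 0 ≤ ‖m‖ := norm_nonneg (toCLM m)
  nlinarith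

theorem core : NormedSpace.Core ℂ (Linking A B X) where
  norm_nonneg m := norm_nonneg (toCLM m)
  norm_smul r m := by rw [norm_def, norm_def, toCLM_smul, norm_smul]
  norm_triangle m n := by rw [norm_def, toCLM_add]; exact norm_add_le _ _
  norm_eq_zero_iff m := by
    constructor
    · intro h
      exact Linking.ext (norm_le_zero_iff.mp (h ▸ norm_a_le m)) (norm_le_zero_iff.mp (h ▸ norm_x_le m))
        (norm_le_zero_iff.mp (h ▸ norm_z_le m)) (norm_le_zero_iff.mp (h ▸ norm_b_le m))
    · rintro rfl
      refine le_antisymm ((norm_le 0).trans ?_) (norm_nonneg (toCLM _))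
      simp [zero_a, zero_x, zero_z, zero_b]

instance instNormed : NormedAddCommGroup (Linking A B X) := NormedAddCommGroup.ofCore core

theorem exists_limit {E : Type*} [NormedAddCommGroup E] [CompleteSpace E]
    {u : ℕ → Linking A B X} (hu : CauchySeq u) (f : Linking A B X → E)
    (hf : ∀ m n, ‖f m - f n‖ ≤ ‖m - n‖) :
    ∃ l, Filter.Tendsto (fun k => f (u k)) Filter.atTop (nhds l) := by
  refine cauchySeq_tendsto_of_complete (Metric.cauchySeq_iff.mpr fun ε hε => ?_)
  obtain ⟨N, hN⟩ := Metric.cauchySeq_iff.mp hu ε hε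
  refine ⟨N, fun m hm n hn => ?_⟩
  have := hN m hm n hn
  rw [dist_eq_norm] at this ⊢
  exact (hf _ _).trans_lt this

theorem norm_sub_le_sum (m n : Linking A B X) :
    ‖m - n‖ ≤ ‖m.a - n.a‖ + ‖m.x - n.x‖ + ‖m.z - n.z‖ + ‖m.b - n.b‖ := by
  have h := norm_le (m - n)
  rwa [sub_a, sub_x, sub_z, sub_b] at h

theorem norm_sub_a_le (m n : Linking A B X) : ‖m.a - n.a‖ ≤ ‖m - n‖ := by
  rw [← sub_a]; exact norm_a_le _
theorem norm_sub_x_le (m n : Linking A B X) : ‖m.x - n.x‖ ≤ ‖m - n‖ := by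
  rw [← sub_x]; exact norm_x_le _
theorem norm_sub_z_le (m n : Linking A B X) : ‖m.z - n.z‖ ≤ ‖m - n‖ := by
  rw [← sub_z]; exact norm_z_le _
theorem norm_sub_b_le (m n : Linking A B X) : ‖m.b - n.b‖ ≤ ‖m - n‖ := by
  rw [← sub_b]; exact norm_b_le _

theorem complete : CompleteSpace (Linking A B X) := by
  have := hX.complete
  refine Metric.complete_of_cauchySeq_tendsto fun u hu => ?_
  obtain ⟨a, ha⟩ := exists_limit hu (fun m => m.a) norm_sub_a_le
  obtain ⟨x, hx⟩ := exists_limit hu (fun m => m.x) norm_sub_x_le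
  obtain ⟨z, hz⟩ := exists_limit hu (fun m => m.z) norm_sub_z_le
  obtain ⟨b, hb⟩ := exists_limit hu (fun m => m.b) norm_sub_b_le
  refine ⟨⟨a, x, z, b⟩, ?_⟩
  rw [tendsto_iff_norm_sub_tendsto_zero] at ha hx hz hb ⊢
  have hs := ((ha.add hx).add hz).add hb
  rw [add_zero, add_zero, add_zero] at hs
  exact squeeze_zero (fun k => norm_nonneg _) (fun k => norm_sub_le_sum (u k) ⟨a, x, z, b⟩) hs

instance instNormedRing : NonUnitalNormedRing (Linking A B X) :=
  { instNormed, instRing with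
    norm_mul_le := fun m n => by
      rw [norm_def, toCLM_mul]
      exact norm_mul_le _ _ }

theorem norm_mul_self_le (m : Linking A B X) : ‖m‖ * ‖m‖ ≤ ‖star m * m‖ := by
  have h0 : ‖m‖ ≤ √‖star m * m‖ := by
    refine ContinuousLinearMap.opNorm_le_bound _ (Real.sqrt_nonneg _) fun v => ?_
    refine le_of_sq_le_sq ?_ (by positivity)
    have h1 := norm_inner_sq_le (B := B) v (mulVec (star m) (mulVec m v))
    have h2 : mulVec (star m) (mulVec m v) = mulVec (star m * m) v :=
      (congrArg (fun T => T v) (toCLM_mul (star m) m)).symm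
    rw [← inner_mulVec, ← Column.norm_sq, ← Column.norm_sq, ← Column.norm_sq, h2, ← mul_pow] at h1
    have h3 := (le_of_sq_le_sq h1 (by positivity)).trans
      (mul_le_mul_of_nonneg_left (norm_mulVec_le (star m * m) v) (norm_nonneg v))
    rw [mul_pow, Real.sq_sqrt (norm_nonneg _)]
    calc ‖toCLM m v‖ ^ 2 ≤ _ := h3
      _ = _ := by ring
  calc ‖m‖ * ‖m‖ ≤ √‖star m * m‖ * √‖star m * m‖ := by gcongr
    _ = _ := Real.mul_self_sqrt (norm_nonneg _)

/-- The linking algebra as a C⋆-algebra. -/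
instance instCStar : NonUnitalCStarAlgebra (Linking A B X) where
  toCompleteSpace := complete
  norm_mul_self_le m := norm_mul_self_le m
  norm_smul_le r m := (core.norm_smul r m).le

open scoped MultiplierAlgebra

/-- The projection `p = (1 0; 0 0)` in `M(L(X))`, acting by left and right multiplication. -/
def projP : 𝓜(ℂ, Linking A B X) where
  fst := LinearMap.mkContinuous
    { toFun := fun m => ⟨m.a, m.x, 0, 0⟩
      map_add' := fun m n => Linking.ext rfl rfl (add_zero _).symm (add_zero _).symm
      map_smul' := fun r m => Linking.ext rfl rfl (smul_zero _).symm (smul_zero _).symm } 2 fun m => by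
    refine (norm_le _).trans ?_
    have := norm_a_le m
    have := norm_x_le m
    simp only [LinearMap.coe_mk, AddHom.coe_mk, norm_zero]
    linarith
  snd := LinearMap.mkContinuous
    { toFun := fun m => ⟨m.a, 0, m.z, 0⟩
      map_add' := fun m n => Linking.ext rfl (add_zero _).symm rfl (add_zero _).symm
      map_smul' := fun r m => Linking.ext rfl (smul_zero _).symm rfl (smul_zero _).symm } 2 fun m => by
    refine (norm_le _).trans ?_
    have := norm_a_le m
    have := norm_z_le m
    simp only [LinearMap.coe_mk, AddHom.coe_mk, norm_zero]
    linarith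
  central m n := by
    change (⟨m.a, 0, m.z, 0⟩ * n : Linking A B X) = m * ⟨n.a, n.x, 0, 0⟩
    ext
    · simp only [mul_a, lin_zero_left hX, lin_zero_right hX]
    · simp only [mul_x, zero_rsmul, rsmul_zero hX.toIsPreHilbertModule]
    · simp only [mul_z, star_zero, zero_rsmul, rsmul_zero hX.toIsPreHilbertModule]
    · simp only [mul_b, zero_mul, mul_zero]

/-- The projection `q = (0 0; 0 1)` in `M(L(X))`, acting by left and right multiplication. -/
def projQ : 𝓜(ℂ, Linking A B X) where
  fst := LinearMap.mkContinuous
    { toFun := fun m => ⟨0, 0, m.z, m.b⟩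
      map_add' := fun m n => Linking.ext (add_zero _).symm (add_zero _).symm rfl rfl
      map_smul' := fun r m => Linking.ext (smul_zero _).symm (smul_zero _).symm rfl rfl } 2 fun m => by
    refine (norm_le _).trans ?_
    have := norm_b_le m
    have := norm_z_le m
    simp only [LinearMap.coe_mk, AddHom.coe_mk, norm_zero]
    linarith
  snd := LinearMap.mkContinuous
    { toFun := fun m => ⟨0, m.x, 0, m.b⟩
      map_add' := fun m n => Linking.ext (add_zero _).symm rfl (add_zero _).symm rfl
      map_smul' := fun r m => Linking.ext (smul_zero _).symm rfl (smul_zero _).symm rfl } 2 fun m => by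
    refine (norm_le _).trans ?_
    have := norm_b_le m
    have := norm_x_le m
    simp only [LinearMap.coe_mk, AddHom.coe_mk, norm_zero]
    linarith
  central m n := by
    change (⟨0, m.x, 0, m.b⟩ * n : Linking A B X) = m * ⟨0, 0, n.z, n.b⟩
    ext
    · simp only [mul_a, zero_mul, mul_zero]
    · simp only [mul_x, zero_lsmul hX.toIsAdjointableAction, lsmul_zero hX.toIsAdjointableAction]
    · simp only [mul_z, star_zero, zero_lsmul hX.toIsAdjointableAction,
        lsmul_zero hX.toIsAdjointableAction]
    · simp only [mul_b, inner_zero_left, inner_zero_right]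

variable (A B X) in
/-- The identification of `A` with the corner `p L(X) p`. -/
def ofA (a : A) : Linking A B X := ⟨a, 0, 0, 0⟩

variable (A B X) in
/-- The identification of `X` with the corner `p L(X) q`. -/
def ofX (x : X) : Linking A B X := ⟨0, x, 0, 0⟩

variable (A B X) in
/-- The identification of `B` with the corner `q L(X) q`. -/
def ofB (b : B) : Linking A B X := ⟨0, 0, 0, b⟩

end Linking

/-! ### Multipliers acting on bimodules, and corners -/

section Multiplier

open Filter Topology
open scoped MultiplierAlgebra

attribute [local instance] CStarAlgebra.spectralOrder CStarAlgebra.spectralOrderedRing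

section Abstract

variable {E W : Type*} [NonUnitalCStarAlgebra E] [NormedAddCommGroup W] [NormedSpace ℂ W]

theorem tendsto_of_dense {ρ : E → W →ₗ[ℂ] W} (hρ : ∀ e w, ‖ρ e w‖ ≤ ‖e‖ * ‖w‖) {S : Set W}
    (hS : Dense (Submodule.span ℂ S : Set W))
    (h : ∀ w ∈ S, Tendsto (fun u => ρ u w) (CStarAlgebra.approximateUnit E) (𝓝 w)) (w : W) :
    Tendsto (fun u => ρ u w) (CStarAlgebra.approximateUnit E) (𝓝 w) := by
  have hspan : ∀ w ∈ Submodule.span ℂ S,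
      Tendsto (fun u => ρ u w) (CStarAlgebra.approximateUnit E) (𝓝 w) := by
    intro w hw
    induction hw using Submodule.span_induction with
    | mem w hw => exact h w hw
    | zero => simp
    | add v w _ _ hv hw => simpa using hv.add hw
    | smul r w _ hw => simpa using hw.const_smul r
  rw [Metric.tendsto_nhds]
  intro ε hε
  obtain ⟨v, hv, hvw⟩ := Metric.mem_closure_iff.mp (hS w) (ε / 3) (by positivity)
  filter_upwards [Metric.tendsto_nhds.mp (hspan v hv) (ε / 3) (by positivity),
    (CStarAlgebra.increasingApproximateUnit E).eventually_norm] with u hu hu1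
  rw [dist_eq_norm] at *
  have h1 : ‖ρ u (w - v)‖ ≤ ‖w - v‖ := (hρ u _).trans
    (mul_le_of_le_one_left (norm_nonneg _) hu1)
  have h2 : ρ u w - w = ρ u (w - v) + (ρ u v - v) - (w - v) := by rw [map_sub]; abel
  rw [h2]
  calc _ ≤ ‖ρ u (w - v)‖ + ‖ρ u v - v‖ + ‖w - v‖ :=
        (norm_sub_le _ _).trans (by gcongr; exact norm_add_le _ _)
    _ < ε := by linarith

theorem exists_multiplier [CompleteSpace W] {ρ : E → W →ₗ[ℂ] W}
    (hρ : ∀ e w, ‖ρ e w‖ ≤ ‖e‖ * ‖w‖)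
    (happ : ∀ w, Tendsto (fun u => ρ u w) (CStarAlgebra.approximateUnit E) (𝓝 w))
    (σ : E →L[ℂ] E) {S : Set W} (hS : Dense (Submodule.span ℂ S : Set W))
    (hgen : ∀ w ∈ S, ∃ w', ∀ e, ρ e w' = ρ (σ e) w) (w : W) :
    ∃ w', ∀ e, ρ e w' = ρ (σ e) w := by
  have hspan : ∀ w ∈ Submodule.span ℂ S, ∃ w', ∀ e, ρ e w' = ρ (σ e) w := by
    intro w hw
    induction hw using Submodule.span_induction with
    | mem w hw => exact hgen w hw
    | zero => exact ⟨0, fun e => by simp⟩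
    | add v w _ _ hv hw =>
      obtain ⟨v', hv⟩ := hv
      obtain ⟨w', hw⟩ := hw
      exact ⟨v' + w', fun e => by rw [map_add, map_add, hv, hw]⟩
    | smul r w _ hw =>
      obtain ⟨w', hw⟩ := hw
      exact ⟨r • w', fun e => by rw [map_smul, map_smul, hw]⟩
  have hbound : ∀ w w', (∀ e, ρ e w' = ρ (σ e) w) → ‖w'‖ ≤ ‖σ‖ * ‖w‖ := by
    intro w w' h
    refine le_of_tendsto (happ w').norm ?_
    filter_upwards [(CStarAlgebra.increasingApproximateUnit E).eventually_norm] with u hu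
    rw [h]
    refine (hρ _ _).trans (mul_le_mul_of_nonneg_right ?_ (norm_nonneg w))
    exact (σ.le_opNorm u).trans (mul_le_of_le_one_right (norm_nonneg _) hu)
  obtain ⟨v, hv, hvw⟩ := mem_closure_iff_seq_limit.mp (hS w)
  choose v' hv' using fun n => hspan (v n) (hv n)
  have hc : CauchySeq v' := by
    rw [Metric.cauchySeq_iff]
    intro ε hε
    obtain ⟨N, hN⟩ := Metric.cauchySeq_iff.mp hvw.cauchySeq (ε / (‖σ‖ + 1)) (by positivity)
    refine ⟨N, fun m hm n hn => ?_⟩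
    have h1 := hN m hm n hn
    rw [dist_eq_norm] at h1 ⊢
    have h2 := hbound (v m - v n) (v' m - v' n) fun e => by rw [map_sub, map_sub, hv', hv']
    rw [lt_div_iff₀ (by positivity)] at h1
    have := norm_nonneg (v m - v n)
    linarith
  obtain ⟨w', hw'⟩ := cauchySeq_tendsto_of_complete hc
  refine ⟨w', fun e => ?_⟩
  have hcont : ∀ e, Continuous (ρ e) := fun e =>
    (LinearMap.mkContinuous (ρ e) ‖e‖ (hρ e)).continuous
  refine tendsto_nhds_unique (((hcont e).tendsto w').comp hw') ?_
  refine (((hcont (σ e)).tendsto w).comp hvw).congr fun n => ?_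
  exact (hv' n e).symm

end Abstract

variable {E F W : Type*} [NonUnitalCStarAlgebra E] [NonUnitalCStarAlgebra F]
  [NormedAddCommGroup W] [NormedSpace ℂ W] [SMul E W] [SMul Fᵐᵒᵖ W] [Inner F W]

theorem approx_left (hW : IsRightHilbertBimodule E F W) (w : W) :
    Tendsto (fun u : E => u • w) (CStarAlgebra.approximateUnit E) (𝓝 w) := by
  refine tendsto_of_dense (ρ := lsmulLin F W) (fun e w => norm_lsmul_le (B := F) e w)
    hW.nondegenerate ?_ w
  rintro _ ⟨e, w, rfl⟩
  have h1 : Continuous fun e : E => e • w :=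
    (LinearMap.mkContinuous
      ({ toFun := fun e : E => e • w
         map_add' := fun e e' => hW.add_lsmul e e' w
         map_smul' := fun r e => hW.smul_lsmul r e w } : E →ₗ[ℂ] W) ‖w‖ fun e => by
      rw [mul_comm]; exact norm_lsmul_le (B := F) e w).continuous
  have h2 := (h1.tendsto e).comp
    ((CStarAlgebra.increasingApproximateUnit E).tendsto_mul_right e)
  exact h2.congr fun u => hW.mul_lsmul u e w

theorem approx_right (hW : IsHilbertModule F W) (w : W) :
    Tendsto (fun u : F => w <• u) (CStarAlgebra.approximateUnit F) (𝓝 w) := by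
  rw [tendsto_iff_norm_sub_tendsto_zero]
  have h1 := (CStarAlgebra.increasingApproximateUnit F).tendsto_mul_right (inner F w w)
  rw [tendsto_iff_norm_sub_tendsto_zero] at h1
  have h2 : Tendsto (fun u : F => √(2 * ‖u * inner F w w - inner F w w‖))
      (CStarAlgebra.approximateUnit F) (𝓝 0) := by
    have := (Real.continuous_sqrt.tendsto _).comp (h1.const_mul 2)
    simpa only [mul_zero, Real.sqrt_zero, Function.comp_def] using this
  refine squeeze_zero' (.of_forall fun u => norm_nonneg _) ?_ h2
  filter_upwards [(CStarAlgebra.increasingApproximateUnit F).eventually_norm,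
    (CStarAlgebra.increasingApproximateUnit F).eventually_star_eq] with u hu hu'
  refine Real.le_sqrt_of_sq_le ?_
  rw [hW.norm_sq_eq]
  have e : inner F (w <• u - w) (w <• u - w) =
      (u * inner F w w - inner F w w) * u - (u * inner F w w - inner F w w) := by
    rw [inner_sub_left, inner_sub_right, inner_sub_right]
    simp only [inner_rsmul_left, inner_rsmul_right, hu', sub_mul]
    abel
  rw [e]
  set k := u * inner F w w - inner F w w
  calc ‖k * u - k‖ ≤ ‖k * u‖ + ‖k‖ := norm_sub_le _ _
    _ ≤ ‖k‖ * 1 + ‖k‖ := by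
        gcongr
        exact (norm_mul_le _ _).trans (by gcongr)
    _ = _ := by ring

theorem ext_lsmul (hW : IsRightHilbertBimodule E F W) {w w' : W} (h : ∀ e : E, e • w = e • w') :
    w = w' :=
  tendsto_nhds_unique (approx_left hW w) ((approx_left hW w').congr fun u => (h u).symm)

theorem ext_rsmul (hW : IsHilbertModule F W) {w w' : W} (h : ∀ f : F, w <• f = w' <• f) :
    w = w' :=
  tendsto_nhds_unique (approx_right hW w) ((approx_right hW w').congr fun u => (h u).symm)

theorem exists_leftMul (hW : IsRightHilbertBimodule E F W) (m : 𝓜(ℂ, E)) (w : W) :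
    ∃ w' : W, ∀ e : E, e • w' = m.snd e • w := by
  have := hW.complete
  refine exists_multiplier (ρ := lsmulLin F W) (fun e w => norm_lsmul_le (B := F) e w)
    (approx_left hW) m.snd hW.nondegenerate ?_ w
  rintro _ ⟨e, w, rfl⟩
  refine ⟨m.fst e • w, fun e' => ?_⟩
  change e' • (m.fst e • w) = m.snd e' • (e • w)
  rw [← hW.mul_lsmul, ← hW.mul_lsmul, m.central]

theorem exists_rightMul (hW : IsHilbertModule F W) (m : 𝓜(ℂ, F)) (w : W) :
    ∃ w' : W, ∀ f : F, w' <• f = w <• m.fst f := by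
  have := hW.complete
  refine exists_multiplier (ρ := rsmulLin W)
    (fun e w => (norm_rsmul_le w e).trans_eq (mul_comm _ _))
    (approx_right hW) m.fst (S := {z | ∃ (w : W) (f : F), z = w <• f}) ?_ ?_ w
  · intro w
    exact mem_closure_of_tendsto (approx_right hW w)
      (.of_forall fun u => Submodule.subset_span ⟨w, u, rfl⟩)
  rintro _ ⟨w, f, rfl⟩
  refine ⟨w <• m.snd f, fun f' => ?_⟩
  change (w <• m.snd f) <• f' = (w <• f) <• m.fst f'
  rw [← hW.rsmul_mul, ← hW.rsmul_mul, m.central]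

variable (F W) in
/-- The left action of a multiplier `m` of `E` on a right-Hilbert `E`–`F` bimodule, by extension
of the nondegenerate left action: `m w` is the unique vector with `e • (m w) = (e m) • w` for all
`e` in `E`. (Equivalently `m (e • w) = (m e) • w`, see `leftMul_lsmul`.) -/
def leftMul [hW : IsRightHilbertBimodule E F W] (m : 𝓜(ℂ, E)) : W →ₗ[ℂ] W where
  toFun w := (exists_leftMul hW m w).choose
  map_add' w w' := ext_lsmul hW fun e => by
    rw [hW.lsmul_add, (exists_leftMul hW m _).choose_spec, (exists_leftMul hW m _).choose_spec,
      (exists_leftMul hW m _).choose_spec, hW.lsmul_add]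
  map_smul' r w := ext_lsmul hW fun e => by
    rw [RingHom.id_apply, hW.lsmul_smul, (exists_leftMul hW m _).choose_spec,
      (exists_leftMul hW m _).choose_spec, hW.lsmul_smul]

variable (W) in
/-- The right action of a multiplier `m` of `F` on a Hilbert `F`-module: `w m` is the unique vector
with `(w m) <• f = w <• (m f)` for all `f` in `F`. (Equivalently `(w <• f) m = w <• (f m)`, see
`rightMul_rsmul`.) -/
def rightMul [hW : IsHilbertModule F W] (m : 𝓜(ℂ, F)) : W →ₗ[ℂ] W where
  toFun w := (exists_rightMul hW m w).choose
  map_add' w w' := ext_rsmul hW fun e => by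
    rw [hW.add_rsmul, (exists_rightMul hW m _).choose_spec, (exists_rightMul hW m _).choose_spec,
      (exists_rightMul hW m _).choose_spec, hW.add_rsmul]
  map_smul' r w := ext_rsmul hW fun e => by
    rw [RingHom.id_apply, hW.smul_rsmul, (exists_rightMul hW m _).choose_spec,
      (exists_rightMul hW m _).choose_spec, hW.smul_rsmul]

theorem rightMul_rsmul' [hW : IsHilbertModule F W] (m : 𝓜(ℂ, F)) (w : W) (f : F) : rightMul W m w <• f = w <• m.fst f :=
  (exists_rightMul hW m w).choose_spec f

theorem rightMul_rsmul [hW : IsHilbertModule F W] (m : 𝓜(ℂ, F)) (w : W) (f : F) : rightMul W m (w <• f) = w <• m.snd f :=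
  ext_rsmul hW fun f' => by
    rw [rightMul_rsmul', ← hW.rsmul_mul, ← hW.rsmul_mul, m.central]

section

variable [hW : IsRightHilbertBimodule E F W]

theorem lsmul_leftMul (m : 𝓜(ℂ, E)) (e : E) (w : W) : e • leftMul F W m w = m.snd e • w :=
  (exists_leftMul hW m w).choose_spec e

theorem leftMul_lsmul (m : 𝓜(ℂ, E)) (e : E) (w : W) : leftMul F W m (e • w) = m.fst e • w :=
  ext_lsmul hW fun e' => by
    rw [lsmul_leftMul, ← hW.mul_lsmul, ← hW.mul_lsmul, m.central]

theorem leftMul_rsmul (m : 𝓜(ℂ, E)) (w : W) (f : F) :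
    leftMul F W m (w <• f) = leftMul F W m w <• f :=
  ext_lsmul hW fun e => by
    rw [lsmul_leftMul, hW.lsmul_rsmul, hW.lsmul_rsmul, lsmul_leftMul]

theorem rightMul_lsmul (m : 𝓜(ℂ, F)) (e : E) (w : W) :
    rightMul W m (e • w) = e • rightMul W m w :=
  ext_rsmul hW.toIsHilbertModule fun f => by
    rw [rightMul_rsmul', ← hW.lsmul_rsmul, ← hW.lsmul_rsmul, rightMul_rsmul']

end

variable (W) in
/-- The corner `P W Q` of a right-Hilbert `E`–`F` bimodule `W`, for multipliers `P` of `E` and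
`Q` of `F`. -/
def corner [IsRightHilbertBimodule E F W] (P : 𝓜(ℂ, E)) (Q : 𝓜(ℂ, F)) : Submodule ℂ W :=
  LinearMap.range (leftMul F W P ∘ₗ rightMul W Q)

theorem lsmul_mem_corner [hW : IsRightHilbertBimodule E F W] {P : 𝓜(ℂ, E)} {Q : 𝓜(ℂ, F)} {e : E}
    (he : P.fst e = P.snd e) {w : W} (hw : w ∈ corner W P Q) : e • w ∈ corner W P Q := by
  obtain ⟨z, rfl⟩ := hw
  refine ⟨e • z, ?_⟩
  rw [LinearMap.comp_apply, LinearMap.comp_apply, rightMul_lsmul, leftMul_lsmul, lsmul_leftMul, he]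

theorem rsmul_mem_corner [hW : IsRightHilbertBimodule E F W] {P : 𝓜(ℂ, E)} {Q : 𝓜(ℂ, F)} {f : F}
    (hf : Q.fst f = Q.snd f) {w : W} (hw : w ∈ corner W P Q) : w <• f ∈ corner W P Q := by
  obtain ⟨z, rfl⟩ := hw
  refine ⟨z <• f, ?_⟩
  rw [LinearMap.comp_apply, LinearMap.comp_apply, rightMul_rsmul, ← leftMul_rsmul, rightMul_rsmul',
    hf]

end Multiplier

section Corners

open Linking

variable (A B C D X Y Z : Type*) [NonUnitalCStarAlgebra A] [NonUnitalCStarAlgebra B]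
  [NonUnitalCStarAlgebra C] [NonUnitalCStarAlgebra D]
  [NormedAddCommGroup X] [NormedSpace ℂ X] [SMul A X] [SMul Bᵐᵒᵖ X] [LeftInner A X] [Inner B X]
  [IsImprimitivityBimodule A B X]
  [NormedAddCommGroup Y] [NormedSpace ℂ Y] [SMul C Y] [SMul Dᵐᵒᵖ Y] [LeftInner C Y] [Inner D Y]
  [IsImprimitivityBimodule C D Y]
  [NormedAddCommGroup Z] [NormedSpace ℂ Z] [SMul (Linking A B X) Z] [SMul (Linking C D Y)ᵐᵒᵖ Z]
  [Inner (Linking C D Y) Z] [IsRightHilbertBimodule (Linking A B X) (Linking C D Y) Z]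

/-- The corner `pZp = p_{L(X)} Z p_{L(Y)}`. -/
def PZP : Submodule ℂ Z :=
  corner Z (projP (A := A) (B := B) (X := X)) (projP (A := C) (B := D) (X := Y))

/-- The corner `qZq = q_{L(X)} Z q_{L(Y)}`. -/
def QZQ : Submodule ℂ Z :=
  corner Z (projQ (A := A) (B := B) (X := X)) (projQ (A := C) (B := D) (X := Y))

/-- The corner `pZq = p_{L(X)} Z q_{L(Y)}`. -/
def PZQ : Submodule ℂ Z :=
  corner Z (projP (A := A) (B := B) (X := X)) (projQ (A := C) (B := D) (X := Y))

/-! The algebras `A = pL(X)p`, `B = qL(X)q` act on the left of the corners of `Z` and the algebras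
`C = pL(Y)p`, `D = qL(Y)q` on the right, by restricting the actions of `L(X)` and `L(Y)` on `Z`. The
inner products are the corresponding entries of the `L(Y)`-valued inner product. -/

instance : SMul A (PZP A B C D X Y Z) :=
  ⟨fun a w => ⟨ofA A B X a • w.1, lsmul_mem_corner rfl w.2⟩⟩

instance : SMul Cᵐᵒᵖ (PZP A B C D X Y Z) :=
  ⟨fun c w => ⟨w.1 <• ofA C D Y c.unop, rsmul_mem_corner rfl w.2⟩⟩

instance : Inner C (PZP A B C D X Y Z) := ⟨fun v w => (inner (Linking C D Y) v.1 w.1).a⟩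

instance : SMul B (QZQ A B C D X Y Z) :=
  ⟨fun b w => ⟨ofB A B X b • w.1, lsmul_mem_corner rfl w.2⟩⟩

instance : SMul Dᵐᵒᵖ (QZQ A B C D X Y Z) :=
  ⟨fun d w => ⟨w.1 <• ofB C D Y d.unop, rsmul_mem_corner rfl w.2⟩⟩

instance : Inner D (QZQ A B C D X Y Z) := ⟨fun v w => (inner (Linking C D Y) v.1 w.1).b⟩

instance : SMul A (PZQ A B C D X Y Z) :=
  ⟨fun a w => ⟨ofA A B X a • w.1, lsmul_mem_corner rfl w.2⟩⟩

instance : SMul Dᵐᵒᵖ (PZQ A B C D X Y Z) :=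
  ⟨fun d w => ⟨w.1 <• ofB C D Y d.unop, rsmul_mem_corner rfl w.2⟩⟩

instance : Inner D (PZQ A B C D X Y Z) := ⟨fun v w => (inner (Linking C D Y) v.1 w.1).b⟩

end Corners

/-- An isomorphism of right-Hilbert `A`–`B` bimodules: a linear bijection preserving the actions
and the inner product. -/
structure RightHilbertIso (A B X Y : Type*) [AddCommGroup X] [Module ℂ X] [SMul A X]
    [SMul Bᵐᵒᵖ X] [Inner B X] [AddCommGroup Y] [Module ℂ Y] [SMul A Y] [SMul Bᵐᵒᵖ Y]
    [Inner B Y] extends X ≃ₗ[ℂ] Y where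
  map_lsmul (a : A) (x : X) : toFun (a • x) = a • toFun x
  map_rsmul (x : X) (b : B) : toFun (x <• b) = toFun x <• b
  inner_map (x y : X) : inner B (toFun x) (toFun y) = inner B x y

end HilbertBimod

end

/-!
# Corners of a bimodule over two linking algebras

Write `p`, `q` for the complementary projections of a linking algebra.

*The corners.* For a right-Hilbert `E`–`F` bimodule `W` and projections `P`, `Q` in the multiplier
algebras, `P W Q` inherits every algebraic axiom, and it is complete because it is closed; its
inner products lie in `Q F Q`. What needs an argument is that the left action is nondegenerate and
that the inner product is full.
* Nondegeneracy: `P W Q` is densely spanned by `P E • W Q`, and `P E P` acts nondegenerately on `P E`.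
  For `E = L(X)` this is because `pE` has the entries `A` and `X`, and `qE` the entries `X~` and `B`.
* Fullness: put `P' = 1 - P`. If `P' W` is densely spanned by `T • W` for some set `T` of elements of
  `P' E P`, then inner products of vectors of `P' W Q` are limits of combinations of elements
  `⟨z, t • w⟩ = ⟨t⋆ • z, w⟩`, which are inner products of vectors of `P W Q` after compression. Hence
  `P W Q` spans the compression of the inner products of `W` (`entry_inner_mem_closure`). For linking
  algebras, `T` is `X` or its adjoint: since `⟨X, X⟩` spans `A` on the left and `B` on the right,
  `X • Z` spans `p Z` and `X⋆ • Z` spans `q Z`.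

`IsCorner` records what is needed of a projection, and `isRightHilbertBimodule_corner` is the result.

*The isomorphisms.* The bilinear maps `(x, z) ↦ x • z` on `X × qZq` and `(w, y) ↦ w <• y` on
`pZp × Y` carry the inner products of the internal tensor products to that of `pZq`, as `x⋆ x'` is the
matrix in `L(X)` whose only nonzero entry is `⟨x, x'⟩` in `B`, and likewise in `L(Y)`. The same density of `X • Z` in `p Z`, and of
`Z <• Y` in `Z q`, shows that their ranges span dense subspaces, so that they extend to isometric
bijections on the completions (`exists_iso_internalTensor`).
-/

noncomputable section

namespace HilbertBimod

open Filter Topology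
open scoped MultiplierAlgebra
open LeftInner (lin)

/-! ### Isomorphisms out of the internal tensor product -/

section Tensor

variable {A B C X Y W : Type*} [NonUnitalCStarAlgebra A] [NonUnitalCStarAlgebra B]
  [NonUnitalCStarAlgebra C]
  [NormedAddCommGroup X] [NormedSpace ℂ X] [SMul A X] [SMul Bᵐᵒᵖ X] [Inner B X]
  [NormedAddCommGroup Y] [NormedSpace ℂ Y] [SMul B Y] [SMul Cᵐᵒᵖ Y] [Inner C Y]
  [NormedAddCommGroup W] [NormedSpace ℂ W] [SMul A W] [SMul Cᵐᵒᵖ W] [Inner C W]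

theorem continuous_inner_right [IsHilbertModule C W] (w : W) :
    Continuous fun v : W => inner C w v :=
  (LinearMap.mkContinuous (innerRight C w) ‖w‖ fun v => norm_inner_le w v).continuous

theorem continuous_inner [IsHilbertModule C W] :
    Continuous fun p : W × W => inner C p.1 p.2 := by
  rw [continuous_iff_continuousAt]
  rintro ⟨v, w⟩
  rw [ContinuousAt, tendsto_iff_norm_sub_tendsto_zero]
  have h : Tendsto (fun p : W × W => ‖p.1 - v‖ * ‖p.2‖ + ‖v‖ * ‖p.2 - w‖) (𝓝 (v, w)) (𝓝 0) := by
    have : Continuous fun p : W × W => ‖p.1 - v‖ * ‖p.2‖ + ‖v‖ * ‖p.2 - w‖ := by fun_prop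
    simpa using this.tendsto (v, w)
  refine squeeze_zero (fun _ => norm_nonneg _) (fun p => ?_) h
  have e : inner C p.1 p.2 - inner C v w = inner C (p.1 - v) p.2 + inner C v (p.2 - w) := by
    rw [inner_sub_left, inner_sub_right]; abel
  rw [e]
  exact (norm_add_le _ _).trans (add_le_add (norm_inner_le _ _) (norm_inner_le _ _))

variable (B) in
theorem continuous_lsmul [IsHilbertModule B X] [IsAdjointableAction A B X] (a : A) :
    Continuous fun x : X => a • x :=
  (lsmulCLM B X a).continuous

theorem continuous_rsmul [IsHilbertModule B X] (b : B) : Continuous fun x : X => x <• b :=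
  (LinearMap.mkContinuous (rsmulLin X b) ‖b‖ fun x =>
    (norm_rsmul_le x b).trans_eq (mul_comm _ _)).continuous

/-- A bilinear map `β : X × Y → W` into a right-Hilbert bimodule that is compatible with the actions
and with the inner product of `X ⊗_B Y`, and whose range spans a dense subspace, induces an
isomorphism `X ⊗_B Y ≅ W`. Balancedness of `β` is automatic, because `β` preserves the form. -/
theorem exists_iso_internalTensor [IsHilbertModule B X] [IsAdjointableAction A B X]
    [hY : IsRightHilbertBimodule B C Y] [hW : IsRightHilbertBimodule A C W]
    (β : X →ₗ[ℂ] Y →ₗ[ℂ] W) (hl : ∀ (a : A) x y, β (a • x) y = a • β x y)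
    (hr : ∀ x y (c : C), β x (y <• c) = β x y <• c)
    (hi : ∀ x y x' y', inner C (β x y) (β x' y') = inner C y (inner B x x' • y'))
    (hd : Dense (Submodule.span ℂ {w : W | ∃ x y, w = β x y} : Set W)) :
    ∃ Φ : RightHilbertIso A C (InternalTensor B C X Y) W,
      ∀ x y, Φ.toLinearEquiv (InternalTensor.tmul B C X Y x y) = β x y := by
  have := hW.complete
  let φ : AlgTensor B C X Y →ₗ[ℂ] W := TensorProduct.lift β
  have hφt : ∀ x y, φ (AlgTensor.tmul B C X Y x y) = β x y := fun x y => TensorProduct.lift.tmul x y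
  have hφi : ∀ s t, inner C (φ s) (φ t) = inner C s t := by
    intro s t
    induction s using AlgTensor.ind with
    | h0 => rw [map_zero, inner_zero_left, inner_zero_left]
    | ha s s' hs hs' => rw [map_add, inner_add_left, inner_add_left, hs, hs']
    | ht x y =>
      induction t using AlgTensor.ind with
      | h0 => rw [map_zero, inner_zero_right, inner_zero_right]
      | ha t t' ht ht' => rw [map_add, inner_add_right, inner_add_right, ht, ht']
      | ht x' y' => rw [hφt, hφt, hi, AlgTensor.inner_tmul]
  have hφl : ∀ (a : A) t, φ (a • t) = a • φ t := by
    intro a t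
    induction t using AlgTensor.ind with
    | h0 =>
      rw [lsmul_zero (B := C) AlgTensor.instAct, map_zero, lsmul_zero hW.toIsAdjointableAction]
    | ha s t hs ht =>
      rw [IsAdjointableAction.lsmul_add (B := C), map_add, map_add, hW.lsmul_add, hs, ht]
    | ht x y => rw [AlgTensor.lsmul_tmul, hφt, hφt, hl]
  have hφr : ∀ t (c : C), φ (t <• c) = φ t <• c := by
    intro t c
    induction t using AlgTensor.ind with
    | h0 => rw [zero_rsmul, map_zero, zero_rsmul]
    | ha s t hs ht =>
      rw [AlgTensor.instPre.add_rsmul, map_add, map_add, hW.add_rsmul, hs, ht]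
    | ht x y => rw [AlgTensor.tmul_rsmul, hφt, hφt, hr]
  let φi : AlgTensor B C X Y →ₗᵢ[ℂ] W := ⟨φ, fun t => by
    refine (sq_eq_sq₀ (norm_nonneg _) (norm_nonneg _)).mp ?_
    rw [hW.norm_sq_eq, hφi, AlgTensor.norm_sq]⟩
  let Φ : InternalTensor B C X Y →L[ℂ] W := φi.toContinuousLinearMap.fromCompletion
  have hΦ : ∀ t : AlgTensor B C X Y, Φ t = φ t := fun t =>
    φi.toContinuousLinearMap.fromCompletion_apply_coe t
  have hiso : Isometry Φ := φi.isometry.completion_extension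
  have hrange : Dense (Set.range Φ) := by
    refine hd.mono ?_
    change _ ⊆ (LinearMap.range Φ.toLinearMap : Set W)
    rw [SetLike.coe_subset_coe, Submodule.span_le]
    rintro _ ⟨x, y, rfl⟩
    exact ⟨InternalTensor.tmul B C X Y x y, (hΦ _).trans (hφt x y)⟩
  have hsurj : Function.Surjective Φ := by
    rw [← Set.range_eq_univ, ← hiso.isClosedEmbedding.isClosed_range.closure_eq, hrange.closure_eq]
  -- The inner product of the completion is an extension by density, so it agrees with the
  -- continuous map `(s, t) ↦ ⟨Φ s, Φ t⟩`.
  have hΦi : ∀ s t, inner C (Φ s) (Φ t) = inner C s t := by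
    intro s t
    have h := (UniformSpace.Completion.isDenseInducing_coe.prodMap
      UniformSpace.Completion.isDenseInducing_coe).extend_unique
      (f := fun p : AlgTensor B C X Y × AlgTensor B C X Y => inner C p.1 p.2)
      (g := fun p : InternalTensor B C X Y × InternalTensor B C X Y => inner C (Φ p.1) (Φ p.2))
      (fun p => by
        change inner C (Φ (p.1 : InternalTensor B C X Y)) (Φ (p.2 : InternalTensor B C X Y)) = _
        rw [hΦ, hΦ, hφi])
      (continuous_inner.comp
        ((Φ.continuous.comp continuous_fst).prodMk (Φ.continuous.comp continuous_snd)))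
    exact (congrFun h (s, t)).symm
  refine ⟨{ LinearEquiv.ofBijective Φ.toLinearMap ⟨hiso.injective, hsurj⟩ with
    map_lsmul := fun a t => ?_
    map_rsmul := fun t c => ?_
    inner_map := hΦi }, fun x y => (hΦ _).trans (hφt x y)⟩
  · change Φ (a • t) = a • Φ t
    refine UniformSpace.Completion.induction_on t (isClosed_eq
      (Φ.continuous.comp (continuous_const_smul a))
      ((continuous_lsmul C a).comp Φ.continuous)) fun t => ?_
    rw [← UniformSpace.Completion.coe_smul, hΦ, hΦ, hφl]
  · change Φ (t <• c) = Φ t <• c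
    refine UniformSpace.Completion.induction_on t (isClosed_eq
      (Φ.continuous.comp (continuous_const_smul (MulOpposite.op c)))
      ((continuous_rsmul c).comp Φ.continuous)) fun t => ?_
    rw [← UniformSpace.Completion.coe_smul, hΦ, hΦ, hφr]

end Tensor

/-! ### Multipliers acting on bimodules -/

section Multiplier

attribute [local instance] CStarAlgebra.spectralOrder CStarAlgebra.spectralOrderedRing

variable {E F W : Type*} [NonUnitalCStarAlgebra E] [NonUnitalCStarAlgebra F]
  [NormedAddCommGroup W] [NormedSpace ℂ W] [SMul E W] [SMul Fᵐᵒᵖ W] [Inner F W]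

theorem norm_rightMul_le [hW : IsHilbertModule F W] (m : 𝓜(ℂ, F)) (w : W) :
    ‖rightMul W m w‖ ≤ ‖m.fst‖ * ‖w‖ := by
  refine le_of_tendsto (approx_right hW (rightMul W m w)).norm ?_
  filter_upwards [(CStarAlgebra.increasingApproximateUnit F).eventually_norm] with u hu
  rw [rightMul_rsmul', mul_comm]
  refine (norm_rsmul_le _ _).trans (mul_le_mul_of_nonneg_left ?_ (norm_nonneg w))
  exact (m.fst.le_opNorm u).trans (mul_le_of_le_one_right (norm_nonneg _) hu)

variable (W) in
theorem continuous_rightMul [IsHilbertModule F W] (m : 𝓜(ℂ, F)) : Continuous (rightMul W m) :=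
  (LinearMap.mkContinuous _ _ (norm_rightMul_le (W := W) m)).continuous

theorem inner_rightMul [IsHilbertModule F W] (n : 𝓜(ℂ, F)) (v w : W) :
    inner F v (rightMul W n w) = n.snd (inner F v w) := by
  refine sub_eq_zero.mp ((CStarRing.mul_star_self_eq_zero_iff _).mp ?_)
  rw [sub_mul, sub_eq_zero, ← inner_rsmul_right, rightMul_rsmul', inner_rsmul_right, n.central]

/-- The map `f ↦ w <• f` of a fixed vector `w`, as a bounded linear map. -/
def rorbit [hW : IsHilbertModule F W] (w : W) : F →L[ℂ] W :=
  LinearMap.mkContinuous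
    { toFun := fun f => w <• f
      map_add' := hW.rsmul_add w
      map_smul' := fun r f => hW.rsmul_smul r w f } ‖w‖ (norm_rsmul_le w)

variable [hW : IsRightHilbertBimodule E F W]

variable (E F) in
/-- The map `e ↦ e • w` of a fixed vector `w`, as a bounded linear map. -/
def lorbit (w : W) : E →L[ℂ] W :=
  LinearMap.mkContinuous
    { toFun := fun e => e • w
      map_add' := fun e e' => hW.add_lsmul e e' w
      map_smul' := fun r e => hW.smul_lsmul r e w } ‖w‖ fun e =>
    (norm_lsmul_le (B := F) e w).trans_eq (mul_comm _ _)

theorem lorbit_apply (w : W) (e : E) : lorbit E F w e = e • w := rfl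

theorem norm_leftMul_le (m : 𝓜(ℂ, E)) (w : W) : ‖leftMul F W m w‖ ≤ ‖m.snd‖ * ‖w‖ := by
  refine le_of_tendsto (approx_left hW (leftMul F W m w)).norm ?_
  filter_upwards [(CStarAlgebra.increasingApproximateUnit E).eventually_norm] with u hu
  rw [lsmul_leftMul]
  refine (norm_lsmul_le (B := F) _ _).trans (mul_le_mul_of_nonneg_right ?_ (norm_nonneg w))
  exact (m.snd.le_opNorm u).trans (mul_le_of_le_one_right (norm_nonneg _) hu)

variable (F W) in
theorem continuous_leftMul (m : 𝓜(ℂ, E)) : Continuous (leftMul F W m) :=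
  (LinearMap.mkContinuous _ _ (norm_leftMul_le (F := F) (W := W) m)).continuous

theorem leftMul_rightMul (m : 𝓜(ℂ, E)) (n : 𝓜(ℂ, F)) (w : W) :
    leftMul F W m (rightMul W n w) = rightMul W n (leftMul F W m w) :=
  ext_lsmul hW fun e => by
    rw [lsmul_leftMul, ← rightMul_lsmul, ← rightMul_lsmul, lsmul_leftMul]

end Multiplier

theorem mem_of_mem_closure_span {V V' : Type*} [TopologicalSpace V] [AddCommGroup V] [Module ℂ V]
    [TopologicalSpace V'] [AddCommGroup V'] [Module ℂ V'] (L : V →L[ℂ] V') {s : Set V}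
    {K : Submodule ℂ V'} (hK : IsClosed (K : Set V')) (h : ∀ v ∈ s, L v ∈ K) {v : V}
    (hv : v ∈ closure (Submodule.span ℂ s : Set V)) : L v ∈ K :=
  closure_minimal (t := L ⁻¹' (K : Set V'))
    (Submodule.span_le (p := K.comap L.toLinearMap).mpr h) (hK.preimage L.continuous) hv

/-! ### Corners -/

section Corner

attribute [local instance] CStarAlgebra.spectralOrder CStarAlgebra.spectralOrderedRing

variable {A E G F W : Type*} [NonUnitalCStarAlgebra A] [NonUnitalCStarAlgebra E]
  [NonUnitalCStarAlgebra G] [NonUnitalCStarAlgebra F]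

/-- The multiplier `P` of `E` is a projection, and `incl : A → E` identifies `A` with the corner
`P E P`, onto which `entry : E → A` is the compression `e ↦ P e P`. Here `P.fst` and `P.snd` are left
and right multiplication by `P`. The last field says that `A` acts nondegenerately on `P E`. -/
structure IsCorner (P : 𝓜(ℂ, E)) (incl : A →⋆ₙₐ[ℂ] E) (entry : E →L[ℂ] A) : Prop where
  star_snd_star (e : E) : star (P.snd (star e)) = P.fst e
  fst_fst (e : E) : P.fst (P.fst e) = P.fst e
  entry_incl (a : A) : entry (incl a) = a
  incl_entry (e : E) : incl (entry e) = P.fst (P.snd e)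
  entry_star (e : E) : entry (star e) = star (entry e)
  exists_entry_eq (e : E) : ∃ a, entry (star e * e) = star a * a
  tendsto (e : E) : Tendsto (fun u => incl u * P.fst e) (CStarAlgebra.approximateUnit A)
    (𝓝 (P.fst e))

namespace IsCorner

variable {P : 𝓜(ℂ, E)} {i : A →⋆ₙₐ[ℂ] E} {r : E →L[ℂ] A}

theorem snd_eq (h : IsCorner P i r) (e : E) : P.snd e = star (P.fst (star e)) := by
  rw [← h.star_snd_star, star_star, star_star]

theorem snd_snd (h : IsCorner P i r) (e : E) : P.snd (P.snd e) = P.snd e := by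
  rw [h.snd_eq (P.snd e), h.snd_eq e, star_star, h.fst_fst]

theorem injective (h : IsCorner P i r) : Function.Injective i :=
  Function.LeftInverse.injective h.entry_incl

theorem entry_snd (h : IsCorner P i r) (e : E) : r (P.snd e) = r e :=
  h.injective (by rw [h.incl_entry, h.incl_entry, h.snd_snd])

theorem norm_incl (h : IsCorner P i r) (a : A) : ‖i a‖ = ‖a‖ :=
  NonUnitalStarAlgHom.norm_map i h.injective a

end IsCorner

variable [NormedAddCommGroup W] [NormedSpace ℂ W] [SMul E W] [SMul Fᵐᵒᵖ W] [Inner F W]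
  {P P' : 𝓜(ℂ, E)} {Q : 𝓜(ℂ, F)} {i : A →⋆ₙₐ[ℂ] E} {r : E →L[ℂ] A} {j : G →⋆ₙₐ[ℂ] F}
  {s : F →L[ℂ] G}

section

variable [hW : IsHilbertModule F W]

theorem rightMul_idem (hQ : IsCorner Q j s) (w : W) :
    rightMul W Q (rightMul W Q w) = rightMul W Q w :=
  ext_rsmul hW fun f => by rw [rightMul_rsmul', rightMul_rsmul', rightMul_rsmul', hQ.fst_fst]

theorem entry_inner_rightMul (hQ : IsCorner Q j s) (v w : W) :
    s (inner F v (rightMul W Q w)) = s (inner F v w) := by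
  rw [inner_rightMul, hQ.entry_snd]

theorem entry_inner_rightMul_left (hQ : IsCorner Q j s) (v w : W) :
    s (inner F (rightMul W Q v) w) = s (inner F v w) := by
  rw [← star_inner, hQ.entry_star, entry_inner_rightMul hQ, ← hQ.entry_star, star_inner]

theorem incl_entry_inner (hQ : IsCorner Q j s) {v w : W} (hv : rightMul W Q v = v)
    (hw : rightMul W Q w = w) : j (s (inner F v w)) = inner F v w := by
  have h : ∀ v w : W, rightMul W Q w = w → Q.snd (inner F v w) = inner F v w := fun v w hw => by
    rw [← inner_rightMul, hw]
  rw [hQ.incl_entry, h v w hw, ← hQ.star_snd_star, star_inner, h w v hv, star_inner]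

end

variable [hW : IsRightHilbertBimodule E F W]

theorem leftMul_idem (hP : IsCorner P i r) (w : W) :
    leftMul F W P (leftMul F W P w) = leftMul F W P w :=
  ext_lsmul hW fun e => by rw [lsmul_leftMul, lsmul_leftMul, lsmul_leftMul, hP.snd_snd]

theorem inner_leftMul (hP : IsCorner P i r) (v w : W) :
    inner F (leftMul F W P v) w = inner F v (leftMul F W P w) := by
  have h1 := ((continuous_inner_right (C := F) (leftMul F W P v)).tendsto w).comp (approx_left hW w)
  have h2 := (((continuous_inner_right (C := F) v).comp (continuous_leftMul F W P)).tendsto w).comp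
    (approx_left hW w)
  refine tendsto_nhds_unique h1 (h2.congr fun u => ?_)
  simp only [Function.comp_apply]
  rw [leftMul_lsmul, ← star_star u, ← hW.inner_lsmul_left, lsmul_leftMul, hW.inner_lsmul_left,
    hP.star_snd_star, star_star]

theorem mem_corner_iff (hP : IsCorner P i r) (hQ : IsCorner Q j s) {w : W} :
    w ∈ corner W P Q ↔ leftMul F W P w = w ∧ rightMul W Q w = w := by
  constructor
  · rintro ⟨z, rfl⟩
    rw [LinearMap.comp_apply, leftMul_idem hP, ← leftMul_rightMul, rightMul_idem hQ]
    exact ⟨rfl, rfl⟩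
  · rintro ⟨h1, h2⟩
    exact ⟨w, by rw [LinearMap.comp_apply, h2, h1]⟩

variable (W P Q) in
/-- The compression `w ↦ P w Q` of `W` onto its corner. -/
def cornerCompress : W →L[ℂ] corner W P Q :=
  ⟨(leftMul F W P ∘ₗ rightMul W Q).rangeRestrict,
    ((continuous_leftMul F W P).comp (continuous_rightMul W Q)).subtype_mk _⟩

theorem coe_cornerCompress (w : W) :
    (cornerCompress W P Q w : W) = leftMul F W P (rightMul W Q w) := rfl

theorem cornerCompress_coe (hP : IsCorner P i r) (hQ : IsCorner Q j s) (w : corner W P Q) :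
    cornerCompress W P Q (w : W) = w := Subtype.ext (by
  obtain ⟨h1, h2⟩ := (mem_corner_iff hP hQ).mp w.2
  rw [coe_cornerCompress, h2, h1])

theorem cornerCompress_lsmul (e : E) (w : W) :
    (cornerCompress W P Q (e • w) : W) = P.fst e • rightMul W Q w := by
  rw [coe_cornerCompress, rightMul_lsmul, leftMul_lsmul]

theorem cornerCompress_rsmul (w : W) (f : F) :
    (cornerCompress W P Q (w <• f) : W) = leftMul F W P w <• Q.snd f := by
  rw [coe_cornerCompress, rightMul_rsmul, leftMul_rsmul]

theorem isClosed_corner (hP : IsCorner P i r) (hQ : IsCorner Q j s) :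
    IsClosed (corner W P Q : Set W) := by
  have : (corner W P Q : Set W) = {w | leftMul F W P w = w} ∩ {w | rightMul W Q w = w} :=
    Set.ext fun w => mem_corner_iff hP hQ
  rw [this]
  exact (isClosed_eq (continuous_leftMul F W P) continuous_id).inter
    (isClosed_eq (continuous_rightMul W Q) continuous_id)

theorem leftMul_add_leftMul (hPP : ∀ e, P.snd e + P'.snd e = e) (w : W) :
    leftMul F W P w + leftMul F W P' w = w :=
  ext_lsmul hW fun e => by
    rw [hW.lsmul_add, lsmul_leftMul, lsmul_leftMul, ← hW.add_lsmul, hPP]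

/-- The compressions of the inner products of `W` to `G = Q F Q` lie in the closed span of the inner
products of `P W Q`. For `z = P z + P' z` the contribution of `P z` is clear. The vector `P' z` is a
limit of combinations of vectors `t • w` with `t` in `P' E P`, and
`⟨z Q, t • w⟩ = ⟨t⋆ • (z Q), w⟩` with `t⋆ • (z Q)` in `P W Q`. -/
theorem entry_inner_mem_closure (hP : IsCorner P i r) (hQ : IsCorner Q j s)
    (hPP : ∀ e, P.snd e + P'.snd e = e) {T : Set E} (hT : ∀ t ∈ T, P.fst (star t) = star t)
    (hd : ∀ w : W, leftMul F W P' w ∈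
      closure (Submodule.span ℂ {z : W | ∃ t ∈ T, ∃ w : W, z = t • w} : Set W)) (z w : W) :
    s (inner F z w) ∈ (Submodule.span ℂ {g : G | ∃ v ∈ corner W P Q, ∃ w ∈ corner W P Q,
      g = s (inner F v w)}).topologicalClosure := by
  set K := (Submodule.span ℂ {g : G | ∃ v ∈ corner W P Q, ∃ w ∈ corner W P Q,
      g = s (inner F v w)}).topologicalClosure
  have key : ∀ v ∈ corner W P Q, ∀ w : W, s (inner F v w) ∈ K := by
    intro v hv w
    refine Submodule.le_topologicalClosure _ (Submodule.subset_span
      ⟨v, hv, leftMul F W P (rightMul W Q w), ⟨w, rfl⟩, ?_⟩)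
    rw [← inner_leftMul hP, ((mem_corner_iff hP hQ).mp hv).1, entry_inner_rightMul hQ]
  let L (v : W) : W →L[ℂ] G :=
    s.comp (LinearMap.mkContinuous (innerRight F v) ‖v‖ fun w => norm_inner_le v w)
  have hL : ∀ v w, L v w = s (inner F v w) := fun _ _ => rfl
  rw [← leftMul_add_leftMul (F := F) hPP w, ← entry_inner_rightMul_left hQ, inner_add_right, map_add]
  refine K.add_mem ?_ ?_
  · rw [← inner_leftMul hP]
    exact key _ ⟨z, rfl⟩ _
  · refine mem_of_mem_closure_span (L (rightMul W Q z)) (Submodule.isClosed_topologicalClosure _) ?_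
      (hd w)
    rintro _ ⟨t, ht, w, rfl⟩
    rw [hL, ← star_star t, ← hW.inner_lsmul_left]
    refine key _ ⟨star t • z, ?_⟩ w
    rw [LinearMap.comp_apply, rightMul_lsmul, leftMul_lsmul, hT t ht]

/-- The corner `P W Q` of a right-Hilbert bimodule `W` is a right-Hilbert bimodule over the corners
`A = P E P` and `G = Q F Q`, if `P' W` is densely spanned by `T • W` for a set `T` in `E P`, where
`P' = 1 - P`. -/
theorem isRightHilbertBimodule_corner (hP : IsCorner P i r) (hQ : IsCorner Q j s)
    (hPP : ∀ e, P.snd e + P'.snd e = e) {T : Set E} (hT : ∀ t ∈ T, P.fst (star t) = star t)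
    (hd : ∀ w : W, leftMul F W P' w ∈
      closure (Submodule.span ℂ {z : W | ∃ t ∈ T, ∃ w : W, z = t • w} : Set W))
    {S : Submodule ℂ W} (hS : S = corner W P Q) [SMul A S] [SMul Gᵐᵒᵖ S] [Inner G S]
    (hl : ∀ (a : A) (w : S), ((a • w : S) : W) = i a • (w : W))
    (hr : ∀ (w : S) (g : G), ((w <• g : S) : W) = (w : W) <• j g)
    (hi : ∀ v w : S, inner G v w = s (inner F (v : W) (w : W))) :
    IsRightHilbertBimodule A G S := by
  have hj : ∀ v w : S, j (inner G v w) = inner F (v : W) (w : W) := fun v w => by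
    rw [hi]
    exact incl_entry_inner hQ ((mem_corner_iff hP hQ).mp (hS.le v.2)).2
      ((mem_corner_iff hP hQ).mp (hS.le w.2)).2
  have hcl : IsClosed (S : Set W) := hS ▸ isClosed_corner hP hQ
  have hHilb : IsHilbertModule G S :=
    { add_rsmul := fun x y b => Subtype.ext (by
        simp only [hr, Submodule.coe_add, hW.add_rsmul])
      rsmul_add := fun x b c => Subtype.ext (by
        simp only [hr, Submodule.coe_add, map_add, hW.rsmul_add])
      rsmul_mul := fun x b c => Subtype.ext (by
        simp only [hr, map_mul, hW.rsmul_mul])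
      smul_rsmul := fun c x b => Subtype.ext (by
        simp only [hr, Submodule.coe_smul, hW.smul_rsmul])
      rsmul_smul := fun c x b => Subtype.ext (by
        simp only [hr, Submodule.coe_smul, map_smul, hW.rsmul_smul])
      inner_add_right := fun x y z => by
        rw [hi, hi, hi, Submodule.coe_add, inner_add_right, map_add]
      inner_smul_right := fun c x y => by
        rw [hi, hi, Submodule.coe_smul, inner_smul_right, map_smul]
      inner_rsmul_right := fun x y b => hQ.injective (by
        rw [map_mul, hj, hj, hr, inner_rsmul_right])
      star_inner := fun x y => by
        rw [hi, hi, ← hQ.entry_star, star_inner]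
      inner_self_nonneg := fun x => by
        obtain ⟨c, hc⟩ := inner_self_nonneg (B := F) (x : W)
        rw [hi, hc]
        exact hQ.exists_entry_eq c
      inner_self_eq_zero := fun x hx => Subtype.ext (hW.inner_self_eq_zero _ (by
        rw [← hj, hx, map_zero]))
      norm_sq_eq := fun x => by
        rw [← hQ.norm_incl, hj, ← hW.norm_sq_eq]; rfl
      complete := by
        have := hW.complete
        exact hcl.completeSpace_coe }
  have hAct : IsAdjointableAction A G S :=
    { lsmul_add := fun a x y => Subtype.ext (by
        simp only [hl, Submodule.coe_add, hW.lsmul_add])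
      add_lsmul := fun a a' x => Subtype.ext (by
        simp only [hl, Submodule.coe_add, map_add, hW.add_lsmul])
      mul_lsmul := fun a a' x => Subtype.ext (by
        simp only [hl, map_mul, hW.mul_lsmul])
      lsmul_smul := fun c a x => Subtype.ext (by
        simp only [hl, Submodule.coe_smul, hW.lsmul_smul])
      smul_lsmul := fun c a x => Subtype.ext (by
        simp only [hl, Submodule.coe_smul, map_smul, hW.smul_lsmul])
      lsmul_rsmul := fun a x b => Subtype.ext (by
        simp only [hl, hr, hW.lsmul_rsmul])
      inner_lsmul_left := fun a x y => by
        rw [hi, hi, hl, hl, map_star, hW.inner_lsmul_left] }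
  refine { hHilb, hAct with
    full := fun g => ?_
    nondegenerate := fun w => ?_ }
  · have h : s (j g) ∈ (Submodule.span ℂ {g : G | ∃ v ∈ corner W P Q, ∃ w ∈ corner W P Q,
        g = s (inner F v w)}).topologicalClosure := by
      refine mem_of_mem_closure_span s (Submodule.isClosed_topologicalClosure _) ?_
        (hW.full (j g))
      rintro _ ⟨z, w, rfl⟩
      exact entry_inner_mem_closure hP hQ hPP hT hd z w
    rw [hQ.entry_incl] at h
    refine closure_mono (Submodule.span_mono ?_) h
    rintro _ ⟨v, hv, w, hw, rfl⟩
    exact ⟨⟨v, hS.ge hv⟩, ⟨w, hS.ge hw⟩, (hi ⟨v, hS.ge hv⟩ ⟨w, hS.ge hw⟩).symm⟩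
  · -- The compression `z ↦ P z Q` maps `E • W` onto `P E • W Q`, where `A` acts nondegenerately.
    subst hS
    rw [← cornerCompress_coe hP hQ w]
    refine mem_of_mem_closure_span (K := (Submodule.span ℂ _).topologicalClosure)
      (cornerCompress W P Q) (Submodule.isClosed_topologicalClosure _) ?_ (hW.nondegenerate w)
    rintro _ ⟨e, z, rfl⟩
    have ht : Tendsto (fun u : A => u • cornerCompress W P Q (e • z)) (CStarAlgebra.approximateUnit A)
        (𝓝 (cornerCompress W P Q (e • z))) := by
      rw [tendsto_subtype_rng, cornerCompress_lsmul]
      refine (((lorbit E F (rightMul W Q z)).continuous.tendsto _).comp (hP.tendsto e)).congr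
        fun u => ?_
      rw [Function.comp_apply, lorbit_apply, hl, cornerCompress_lsmul, hW.mul_lsmul]
    exact mem_closure_of_tendsto ht (.of_forall fun u => Submodule.subset_span ⟨u, _, rfl⟩)

end Corner

/-! ### The corners of the linking algebra -/

namespace Linking

attribute [local instance] CStarAlgebra.spectralOrder CStarAlgebra.spectralOrderedRing

variable {A B X : Type*} [NonUnitalCStarAlgebra A] [NonUnitalCStarAlgebra B]
  [NormedAddCommGroup X] [NormedSpace ℂ X] [SMul A X] [SMul Bᵐᵒᵖ X] [LeftInner A X]
  [Inner B X] [hX : IsImprimitivityBimodule A B X]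

theorem ofA_mul_ofA (a a' : A) : ofA A B X a * ofA A B X a' = ofA A B X (a * a') := by
  ext
  · exact (congrArg _ (lin_zero_left hX _)).trans (add_zero _)
  · exact (congrArg₂ _ (lsmul_zero hX.toIsAdjointableAction _) (zero_rsmul _)).trans (add_zero _)
  · exact (congrArg₂ _ (lsmul_zero hX.toIsAdjointableAction _) (zero_rsmul _)).trans (add_zero _)
  · exact (congrArg₂ _ (inner_zero_left _) (zero_mul _)).trans (add_zero _)

theorem ofA_mul_ofX (a : A) (x : X) : ofA A B X a * ofX A B X x = ofX A B X (a • x) := by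
  ext
  · exact (congrArg₂ _ (mul_zero _) (lin_zero_left hX _)).trans (add_zero _)
  · exact (congrArg _ (zero_rsmul _)).trans (add_zero _)
  · exact (congrArg₂ _ (lsmul_zero hX.toIsAdjointableAction _) (zero_rsmul _)).trans (add_zero _)
  · exact (congrArg₂ _ (inner_zero_left _) (zero_mul _)).trans (add_zero _)

theorem ofB_mul_ofB (b b' : B) : ofB A B X b * ofB A B X b' = ofB A B X (b * b') := by
  ext
  · exact (congrArg₂ _ (zero_mul _) (lin_zero_left hX _)).trans (add_zero _)
  · exact (congrArg₂ _ (lsmul_zero hX.toIsAdjointableAction _) (zero_rsmul _)).trans (add_zero _)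
  · exact (congrArg₂ _ (lsmul_zero hX.toIsAdjointableAction _) (zero_rsmul _)).trans (add_zero _)
  · exact (congrArg (· + _) (inner_zero_left _)).trans (zero_add _)

theorem ofX_mul_ofB (x : X) (b : B) : ofX A B X x * ofB A B X b = ofX A B X (x <• b) := by
  ext
  · exact (congrArg₂ _ (zero_mul _) (lin_zero_right hX _)).trans (add_zero _)
  · exact (congrArg (· + _) (lsmul_zero hX.toIsAdjointableAction _)).trans (zero_add _)
  · exact (congrArg₂ _ (lsmul_zero hX.toIsAdjointableAction _) (zero_rsmul _)).trans (add_zero _)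
  · exact (congrArg₂ _ (inner_zero_left _) (zero_mul _)).trans (add_zero _)

theorem ofX_mul_star_ofX (x y : X) :
    ofX A B X x * star (ofX A B X y) = ofA A B X (lin A x y) := by
  ext
  · exact (congrArg (· + _) (zero_mul _)).trans (zero_add _)
  · rw [mul_x, star_x, star_b]
    change (0 : A) • (0 : X) + x <• star (0 : B) = 0
    rw [star_zero, lsmul_zero hX.toIsAdjointableAction, rsmul_zero hX.toIsPreHilbertModule,
      add_zero]
  · rw [mul_z, star_z]
    change _ • (0 : X) + y <• star (0 : B) = 0
    rw [star_zero, lsmul_zero hX.toIsAdjointableAction, rsmul_zero hX.toIsPreHilbertModule,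
      add_zero]
  · exact (congrArg₂ _ (inner_zero_left _) (zero_mul _)).trans (add_zero _)

theorem star_ofX_mul_ofX (x y : X) :
    star (ofX A B X x) * ofX A B X y = ofB A B X (inner B x y) := by
  ext
  · exact (congrArg₂ _ (mul_zero _) (lin_zero_left hX _)).trans (add_zero _)
  · rw [mul_x, star_a, star_x]
    change star (0 : A) • y + (0 : X) <• (0 : B) = 0
    rw [star_zero, zero_lsmul hX.toIsAdjointableAction, zero_rsmul, add_zero]
  · rw [mul_z, star_z]
    change star (0 : A) • x + (0 : X) <• _ = 0
    rw [star_zero, zero_lsmul hX.toIsAdjointableAction, zero_rsmul, add_zero]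
  · exact (congrArg _ (mul_zero _)).trans (add_zero _)

theorem star_ofA (a : A) : star (ofA A B X a) = ofA A B X (star a) :=
  Linking.ext rfl rfl rfl (star_zero _)

theorem star_ofB (b : B) : star (ofB A B X b) = ofB A B X (star b) :=
  Linking.ext (star_zero _) rfl rfl rfl

theorem ofA_injective : Function.Injective (ofA A B X) := fun _ _ h => congrArg Linking.a h

theorem ofB_injective : Function.Injective (ofB A B X) := fun _ _ h => congrArg Linking.b h

variable (A B X) in
/-- The embedding of `A` in `L(X)` as a homomorphism. -/
def ofAHom : A →⋆ₙₐ[ℂ] Linking A B X where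
  toFun := ofA A B X
  map_smul' r a := Linking.ext rfl (smul_zero _).symm (smul_zero _).symm (smul_zero _).symm
  map_zero' := rfl
  map_add' a a' := Linking.ext rfl (add_zero _).symm (add_zero _).symm (add_zero _).symm
  map_mul' a a' := (ofA_mul_ofA a a').symm
  map_star' a := (star_ofA a).symm

variable (A B X) in
/-- The embedding of `B` in `L(X)` as a homomorphism. -/
def ofBHom : B →⋆ₙₐ[ℂ] Linking A B X where
  toFun := ofB A B X
  map_smul' r b := Linking.ext (smul_zero _).symm (smul_zero _).symm (smul_zero _).symm rfl
  map_zero' := rfl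
  map_add' b b' := Linking.ext (add_zero _).symm (add_zero _).symm (add_zero _).symm rfl
  map_mul' b b' := (ofB_mul_ofB b b').symm
  map_star' b := (star_ofB b).symm

variable (A B X) in
/-- The embedding of `X` in `L(X)` as a bounded linear map. -/
def ofXCLM : X →L[ℂ] Linking A B X :=
  LinearMap.mkContinuous
    { toFun := ofX A B X
      map_add' := fun x y => Linking.ext (add_zero _).symm rfl (add_zero _).symm (add_zero _).symm
      map_smul' := fun r x =>
        Linking.ext (smul_zero _).symm rfl (smul_zero _).symm (smul_zero _).symm } 1 fun x => by
    refine (norm_le _).trans_eq ?_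
    simp [ofX]

variable (A B X) in
/-- The upper left entry as a bounded linear map. -/
def entryA : Linking A B X →L[ℂ] A :=
  LinearMap.mkContinuous
    { toFun := fun m => m.a
      map_add' := fun _ _ => rfl
      map_smul' := fun _ _ => rfl } 1 fun m => (norm_a_le m).trans_eq (one_mul _).symm

variable (A B X) in
/-- The lower right entry as a bounded linear map. -/
def entryB : Linking A B X →L[ℂ] B :=
  LinearMap.mkContinuous
    { toFun := fun m => m.b
      map_add' := fun _ _ => rfl
      map_smul' := fun _ _ => rfl } 1 fun m => (norm_b_le m).trans_eq (one_mul _).symm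

theorem projP_fst (m : Linking A B X) :
    (projP : 𝓜(ℂ, Linking A B X)).fst m = ofA A B X m.a + ofX A B X m.x :=
  Linking.ext (add_zero _).symm (zero_add _).symm (add_zero _).symm (add_zero _).symm

theorem projQ_fst (m : Linking A B X) :
    (projQ : 𝓜(ℂ, Linking A B X)).fst m = star (ofX A B X m.z) + ofB A B X m.b := by
  refine Linking.ext ?_ (add_zero _).symm (add_zero _).symm ?_
  · change 0 = star (0 : A) + 0
    rw [star_zero, add_zero]
  · change m.b = star (0 : B) + m.b
    rw [star_zero, zero_add]

theorem projQ_snd (m : Linking A B X) :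
    (projQ : 𝓜(ℂ, Linking A B X)).snd m = ofX A B X m.x + ofB A B X m.b :=
  Linking.ext (add_zero _).symm (add_zero _).symm (add_zero _).symm (zero_add _).symm

theorem projP_snd_add_projQ_snd (m : Linking A B X) :
    (projP : 𝓜(ℂ, Linking A B X)).snd m + (projQ : 𝓜(ℂ, Linking A B X)).snd m = m :=
  Linking.ext (add_zero _) (zero_add _) (add_zero _) (zero_add _)

theorem isCorner_projP :
    IsCorner (projP : 𝓜(ℂ, Linking A B X)) (ofAHom A B X) (entryA A B X) where
  star_snd_star m := Linking.ext (star_star _) rfl rfl (star_zero _)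
  fst_fst _ := rfl
  entry_incl _ := rfl
  incl_entry _ := rfl
  entry_star _ := rfl
  exists_entry_eq m := by
    change ∃ a, star m.a * m.a + lin A m.z m.z = star a * a
    exact exists_star_mul_add ⟨_, rfl⟩ (hX.lin_self_nonneg _)
  tendsto m := by
    rw [projP_fst]
    have h1 := ((NonUnitalStarAlgHom.isometry (ofAHom A B X) ofA_injective).continuous.tendsto _).comp
      ((CStarAlgebra.increasingApproximateUnit A).tendsto_mul_right m.a)
    have h2 := ((ofXCLM A B X).continuous.tendsto _).comp
      (approx_left hX.toIsRightHilbertBimodule m.x)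
    refine (h1.add h2).congr fun u => ?_
    rw [mul_add]
    exact congrArg₂ _ (ofA_mul_ofA u m.a).symm (ofA_mul_ofX u m.x).symm

theorem isCorner_projQ :
    IsCorner (projQ : 𝓜(ℂ, Linking A B X)) (ofBHom A B X) (entryB A B X) where
  star_snd_star m := Linking.ext (star_zero _) rfl rfl (star_star _)
  fst_fst _ := rfl
  entry_incl _ := rfl
  incl_entry _ := rfl
  entry_star _ := rfl
  exists_entry_eq m := by
    change ∃ b, inner B m.x m.x + star m.b * m.b = star b * b
    exact exists_star_mul_add (inner_self_nonneg _) ⟨_, rfl⟩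
  tendsto m := by
    rw [projQ_fst]
    have h1 := ((continuous_star.comp (ofXCLM A B X).continuous).tendsto _).comp
      (approx_right hX.toIsHilbertModule m.z)
    have h2 := ((NonUnitalStarAlgHom.isometry (ofBHom A B X) ofB_injective).continuous.tendsto _).comp
      ((CStarAlgebra.increasingApproximateUnit B).tendsto_mul_right m.b)
    refine (h1.add h2).congr' ?_
    filter_upwards [(CStarAlgebra.increasingApproximateUnit B).eventually_star_eq] with u hu
    rw [mul_add]
    refine congrArg₂ _ ?_ (ofB_mul_ofB u m.b).symm
    change star (ofX A B X (m.z <• u)) = ofB A B X u * star (ofX A B X m.z)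
    rw [← ofX_mul_ofB, star_mul, star_ofB, hu]

end Linking

/-! ### Off-diagonal density -/

section Density

open Linking

section Left

variable {A B X F Z : Type*} [NonUnitalCStarAlgebra A] [NonUnitalCStarAlgebra B]
  [NonUnitalCStarAlgebra F]
  [NormedAddCommGroup X] [NormedSpace ℂ X] [SMul A X] [SMul Bᵐᵒᵖ X] [LeftInner A X]
  [Inner B X] [hX : IsImprimitivityBimodule A B X]
  [NormedAddCommGroup Z] [NormedSpace ℂ Z] [SMul (Linking A B X) Z] [SMul Fᵐᵒᵖ Z] [Inner F Z]
  [hZ : IsRightHilbertBimodule (Linking A B X) F Z]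

/-- `p Z` is densely spanned by `X • Z`, since `A` is densely spanned by `⟨X, X⟩`. -/
theorem leftMul_projP_mem_closure (w : Z) :
    leftMul F Z (projP : 𝓜(ℂ, Linking A B X)) w ∈
      closure (Submodule.span ℂ {z : Z | ∃ t ∈ Set.range (ofX A B X), ∃ w : Z, z = t • w} :
        Set Z) := by
  set K := Submodule.span ℂ {z : Z | ∃ t ∈ Set.range (ofX A B X), ∃ w : Z, z = t • w}
  have hK : ∀ (x : X) (w : Z), ofX A B X x • w ∈ K.topologicalClosure := fun x w =>
    K.le_topologicalClosure (Submodule.subset_span ⟨_, ⟨x, rfl⟩, w, rfl⟩)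
  refine mem_of_mem_closure_span (K := K.topologicalClosure)
    ⟨leftMul F Z (projP : 𝓜(ℂ, Linking A B X)), continuous_leftMul F Z _⟩
    K.isClosed_topologicalClosure ?_ (hZ.nondegenerate w)
  rintro _ ⟨e, z, rfl⟩
  change leftMul F Z (projP : 𝓜(ℂ, Linking A B X)) (e • z) ∈ _
  rw [leftMul_lsmul, projP_fst, hZ.add_lsmul]
  refine add_mem ?_ (hK _ _)
  refine mem_of_mem_closure_span ((lorbit (Linking A B X) F z).comp
    ⟨(ofAHom A B X : A →ₗ[ℂ] Linking A B X),
      (NonUnitalStarAlgHom.isometry (ofAHom A B X) ofA_injective).continuous⟩)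
    K.isClosed_topologicalClosure ?_ (hX.left_full e.a)
  rintro _ ⟨x, y, rfl⟩
  change ofA A B X (lin A x y) • z ∈ _
  rw [← ofX_mul_star_ofX, hZ.mul_lsmul]
  exact hK _ _

/-- `q Z` is densely spanned by `X⋆ • Z`, since `B` is densely spanned by `⟨X, X⟩`. -/
theorem leftMul_projQ_mem_closure (w : Z) :
    leftMul F Z (projQ : 𝓜(ℂ, Linking A B X)) w ∈
      closure (Submodule.span ℂ {z : Z | ∃ t ∈ Set.range fun x => star (ofX A B X x),
        ∃ w : Z, z = t • w} : Set Z) := by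
  set K := Submodule.span ℂ {z : Z | ∃ t ∈ Set.range fun x => star (ofX A B X x),
    ∃ w : Z, z = t • w}
  have hK : ∀ (x : X) (w : Z), star (ofX A B X x) • w ∈ K.topologicalClosure := fun x w =>
    K.le_topologicalClosure (Submodule.subset_span ⟨_, ⟨x, rfl⟩, w, rfl⟩)
  refine mem_of_mem_closure_span (K := K.topologicalClosure)
    ⟨leftMul F Z (projQ : 𝓜(ℂ, Linking A B X)), continuous_leftMul F Z _⟩
    K.isClosed_topologicalClosure ?_ (hZ.nondegenerate w)
  rintro _ ⟨e, z, rfl⟩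
  change leftMul F Z (projQ : 𝓜(ℂ, Linking A B X)) (e • z) ∈ _
  rw [leftMul_lsmul, projQ_fst, hZ.add_lsmul]
  refine add_mem (hK _ _) ?_
  refine mem_of_mem_closure_span ((lorbit (Linking A B X) F z).comp
    ⟨(ofBHom A B X : B →ₗ[ℂ] Linking A B X),
      (NonUnitalStarAlgHom.isometry (ofBHom A B X) ofB_injective).continuous⟩)
    K.isClosed_topologicalClosure ?_ (hX.full e.b)
  rintro _ ⟨x, y, rfl⟩
  change ofB A B X (inner B x y) • z ∈ _
  rw [← star_ofX_mul_ofX, hZ.mul_lsmul]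
  exact hK _ _

end Left

section Right

variable {C D Y Z : Type*} [NonUnitalCStarAlgebra C] [NonUnitalCStarAlgebra D]
  [NormedAddCommGroup Y] [NormedSpace ℂ Y] [SMul C Y] [SMul Dᵐᵒᵖ Y] [LeftInner C Y]
  [Inner D Y] [hY : IsImprimitivityBimodule C D Y]
  [NormedAddCommGroup Z] [NormedSpace ℂ Z] [SMul (Linking C D Y)ᵐᵒᵖ Z] [Inner (Linking C D Y) Z]
  [hZ : IsHilbertModule (Linking C D Y) Z]

/-- `Z q` is densely spanned by `Z <• Y`, since `D` is densely spanned by `⟨Y, Y⟩`. -/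
theorem rightMul_projQ_mem_closure (w : Z) :
    rightMul Z (projQ : 𝓜(ℂ, Linking C D Y)) w ∈
      closure (Submodule.span ℂ {z : Z | ∃ (w : Z) (y : Y), z = w <• ofX C D Y y} : Set Z) := by
  set K := Submodule.span ℂ {z : Z | ∃ (w : Z) (y : Y), z = w <• ofX C D Y y}
  have hK : ∀ (w : Z) (y : Y), w <• ofX C D Y y ∈ K.topologicalClosure := fun w y =>
    K.le_topologicalClosure (Submodule.subset_span ⟨w, y, rfl⟩)
  refine K.isClosed_topologicalClosure.mem_of_tendsto
    (((continuous_rightMul Z (projQ : 𝓜(ℂ, Linking C D Y))).tendsto w).comp (approx_right hZ w))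
    (.of_forall fun u => ?_)
  change rightMul Z (projQ : 𝓜(ℂ, Linking C D Y)) (w <• u) ∈ _
  rw [rightMul_rsmul, projQ_snd, hZ.rsmul_add]
  refine add_mem (hK _ _) ?_
  refine mem_of_mem_closure_span ((rorbit w).comp
    ⟨(ofBHom C D Y : D →ₗ[ℂ] Linking C D Y),
      (NonUnitalStarAlgHom.isometry (ofBHom C D Y) ofB_injective).continuous⟩)
    K.isClosed_topologicalClosure ?_ (hY.full u.b)
  rintro _ ⟨x, y, rfl⟩
  change w <• ofB C D Y (inner D x y) ∈ _
  rw [← star_ofX_mul_ofX, hZ.rsmul_mul]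
  exact hK _ _

end Right

end Density

/-! ### The corners of a bimodule over linking algebras -/

section Corners

open Linking

variable {A B C D X Y Z : Type*} [NonUnitalCStarAlgebra A] [NonUnitalCStarAlgebra B]
  [NonUnitalCStarAlgebra C] [NonUnitalCStarAlgebra D]
  [NormedAddCommGroup X] [NormedSpace ℂ X] [SMul A X] [SMul Bᵐᵒᵖ X] [LeftInner A X] [Inner B X]
  [hX : IsImprimitivityBimodule A B X]
  [NormedAddCommGroup Y] [NormedSpace ℂ Y] [SMul C Y] [SMul Dᵐᵒᵖ Y] [LeftInner C Y] [Inner D Y]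
  [hY : IsImprimitivityBimodule C D Y]
  [NormedAddCommGroup Z] [NormedSpace ℂ Z] [SMul (Linking A B X) Z] [SMul (Linking C D Y)ᵐᵒᵖ Z]
  [Inner (Linking C D Y) Z] [hZ : IsRightHilbertBimodule (Linking A B X) (Linking C D Y) Z]

instance isRightHilbertBimodule_PZP : IsRightHilbertBimodule A C (PZP A B C D X Y Z) :=
  isRightHilbertBimodule_corner (S := PZP A B C D X Y Z)
    (isCorner_projP (A := A) (B := B) (X := X))
    (isCorner_projP (A := C) (B := D) (X := Y)) projP_snd_add_projQ_snd
    (by rintro _ ⟨x, rfl⟩; rw [star_star]; rfl) leftMul_projQ_mem_closure rfl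
    (fun _ _ => rfl) (fun _ _ => rfl) (fun _ _ => rfl)

instance isRightHilbertBimodule_PZQ : IsRightHilbertBimodule A D (PZQ A B C D X Y Z) :=
  isRightHilbertBimodule_corner (S := PZQ A B C D X Y Z)
    (isCorner_projP (A := A) (B := B) (X := X))
    (isCorner_projQ (A := C) (B := D) (X := Y)) projP_snd_add_projQ_snd
    (by rintro _ ⟨x, rfl⟩; rw [star_star]; rfl) leftMul_projQ_mem_closure rfl
    (fun _ _ => rfl) (fun _ _ => rfl) (fun _ _ => rfl)

instance isRightHilbertBimodule_QZQ : IsRightHilbertBimodule B D (QZQ A B C D X Y Z) :=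
  isRightHilbertBimodule_corner (S := QZQ A B C D X Y Z)
    (isCorner_projQ (A := A) (B := B) (X := X))
    (isCorner_projQ (A := C) (B := D) (X := Y))
    (fun m => (add_comm _ _).trans (projP_snd_add_projQ_snd m))
    (by rintro _ ⟨x, rfl⟩; exact Linking.ext (star_zero _).symm rfl rfl rfl)
    leftMul_projP_mem_closure rfl
    (fun _ _ => rfl) (fun _ _ => rfl) (fun _ _ => rfl)

theorem mem_PZP {w : Z} : w ∈ PZP A B C D X Y Z ↔
    leftMul (Linking C D Y) Z (projP : 𝓜(ℂ, Linking A B X)) w = w ∧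
      rightMul Z (projP : 𝓜(ℂ, Linking C D Y)) w = w :=
  mem_corner_iff isCorner_projP isCorner_projP

theorem mem_QZQ {w : Z} : w ∈ QZQ A B C D X Y Z ↔
    leftMul (Linking C D Y) Z (projQ : 𝓜(ℂ, Linking A B X)) w = w ∧
      rightMul Z (projQ : 𝓜(ℂ, Linking C D Y)) w = w :=
  mem_corner_iff isCorner_projQ isCorner_projQ

theorem mem_PZQ {w : Z} : w ∈ PZQ A B C D X Y Z ↔
    leftMul (Linking C D Y) Z (projP : 𝓜(ℂ, Linking A B X)) w = w ∧
      rightMul Z (projQ : 𝓜(ℂ, Linking C D Y)) w = w :=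
  mem_corner_iff isCorner_projP isCorner_projQ

theorem inner_PZP_eq_ofA (v w : PZP A B C D X Y Z) :
    inner (Linking C D Y) (v : Z) (w : Z) = ofA C D Y (inner C v w) :=
  (incl_entry_inner isCorner_projP (mem_PZP.mp v.2).2 (mem_PZP.mp w.2).2).symm

theorem inner_QZQ_eq_ofB (v w : QZQ A B C D X Y Z) :
    inner (Linking C D Y) (v : Z) (w : Z) = ofB C D Y (inner D v w) :=
  (incl_entry_inner isCorner_projQ (mem_QZQ.mp v.2).2 (mem_QZQ.mp w.2).2).symm

theorem inner_PZQ_eq_ofB (v w : PZQ A B C D X Y Z) :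
    inner (Linking C D Y) (v : Z) (w : Z) = ofB C D Y (inner D v w) :=
  (incl_entry_inner isCorner_projQ (mem_PZQ.mp v.2).2 (mem_PZQ.mp w.2).2).symm

theorem ofX_lsmul_mem_PZQ (x : X) {z : Z} (hz : z ∈ QZQ A B C D X Y Z) :
    ofX A B X x • z ∈ PZQ A B C D X Y Z :=
  mem_PZQ.mpr ⟨leftMul_lsmul _ _ _, by rw [rightMul_lsmul, (mem_QZQ.mp hz).2]⟩

theorem rsmul_ofX_mem_PZQ {w : Z} (hw : w ∈ PZP A B C D X Y Z) (y : Y) :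
    w <• ofX C D Y y ∈ PZQ A B C D X Y Z :=
  mem_PZQ.mpr ⟨by rw [leftMul_rsmul, (mem_PZP.mp hw).1], rightMul_rsmul _ _ _⟩

variable (A B C D X Y Z) in
/-- The bilinear map `(x, z) ↦ x • z` from `X × qZq` to `pZq`. -/
def mulX : X →ₗ[ℂ] QZQ A B C D X Y Z →ₗ[ℂ] PZQ A B C D X Y Z :=
  LinearMap.mk₂ ℂ (fun x z => ⟨ofX A B X x • (z : Z), ofX_lsmul_mem_PZQ x z.2⟩)
    (fun x x' z => Subtype.ext <| by
      change ofXCLM A B X (x + x') • (z : Z) = ofXCLM A B X x • (z : Z) + ofXCLM A B X x' • (z : Z)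
      rw [map_add, hZ.add_lsmul])
    (fun r x z => Subtype.ext <| by
      change ofXCLM A B X (r • x) • (z : Z) = r • (ofXCLM A B X x • (z : Z))
      rw [map_smul, hZ.smul_lsmul])
    (fun x z z' => Subtype.ext (hZ.lsmul_add _ _ _))
    (fun r x z => Subtype.ext (hZ.lsmul_smul _ _ _))

variable (A B C D X Y Z) in
/-- The bilinear map `(w, y) ↦ w <• y` from `pZp × Y` to `pZq`. -/
def mulY : PZP A B C D X Y Z →ₗ[ℂ] Y →ₗ[ℂ] PZQ A B C D X Y Z :=
  LinearMap.mk₂ ℂ (fun w y => ⟨(w : Z) <• ofX C D Y y, rsmul_ofX_mem_PZQ w.2 y⟩)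
    (fun w w' y => Subtype.ext (hZ.add_rsmul _ _ _))
    (fun r w y => Subtype.ext (hZ.smul_rsmul _ _ _))
    (fun w y y' => Subtype.ext <| by
      change (w : Z) <• ofXCLM C D Y (y + y') =
        (w : Z) <• ofXCLM C D Y y + (w : Z) <• ofXCLM C D Y y'
      rw [map_add, hZ.rsmul_add])
    (fun r w y => Subtype.ext <| by
      change (w : Z) <• ofXCLM C D Y (r • y) = r • ((w : Z) <• ofXCLM C D Y y)
      rw [map_smul, hZ.rsmul_smul])

theorem coe_mulX (x : X) (z : QZQ A B C D X Y Z) :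
    (mulX A B C D X Y Z x z : Z) = ofX A B X x • (z : Z) := rfl

theorem coe_mulY (w : PZP A B C D X Y Z) (y : Y) :
    (mulY A B C D X Y Z w y : Z) = (w : Z) <• ofX C D Y y := rfl

theorem dense_span_mulX :
    Dense (Submodule.span ℂ {w | ∃ x z, w = mulX A B C D X Y Z x z} :
      Set (PZQ A B C D X Y Z)) := by
  intro w
  have hw := leftMul_projP_mem_closure (A := A) (B := B) (X := X) (F := Linking C D Y) (w : Z)
  rw [(mem_PZQ.mp w.2).1] at hw
  rw [← cornerCompress_coe isCorner_projP isCorner_projQ w]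
  refine mem_of_mem_closure_span (K := (Submodule.span ℂ _).topologicalClosure)
    (cornerCompress Z projP projQ) (Submodule.isClosed_topologicalClosure _) ?_ hw
  rintro _ ⟨_, ⟨x, rfl⟩, z, rfl⟩
  refine Submodule.le_topologicalClosure _ (Submodule.subset_span
    ⟨x, ⟨leftMul (Linking C D Y) Z projQ (rightMul Z projQ z), ⟨z, rfl⟩⟩, Subtype.ext ?_⟩)
  rw [cornerCompress_lsmul, coe_mulX, lsmul_leftMul]
  rfl

theorem dense_span_mulY :
    Dense (Submodule.span ℂ {w | ∃ z y, w = mulY A B C D X Y Z z y} :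
      Set (PZQ A B C D X Y Z)) := by
  intro w
  have hw := rightMul_projQ_mem_closure (C := C) (D := D) (Y := Y) (w : Z)
  rw [(mem_PZQ.mp w.2).2] at hw
  rw [← cornerCompress_coe isCorner_projP isCorner_projQ w]
  refine mem_of_mem_closure_span (K := (Submodule.span ℂ _).topologicalClosure)
    (cornerCompress Z projP projQ) (Submodule.isClosed_topologicalClosure _) ?_ hw
  rintro _ ⟨z, y, rfl⟩
  refine Submodule.le_topologicalClosure _ (Submodule.subset_span
    ⟨⟨leftMul (Linking C D Y) Z projP (rightMul Z projP z), ⟨z, rfl⟩⟩, y, Subtype.ext ?_⟩)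
  rw [cornerCompress_rsmul, coe_mulY]
  change _ = leftMul (Linking C D Y) Z projP (rightMul Z projP z) <• ofX C D Y y
  rw [leftMul_rightMul, rightMul_rsmul']
  rfl

theorem inner_mulX (x : X) (z : QZQ A B C D X Y Z) (x' : X) (z' : QZQ A B C D X Y Z) :
    inner D (mulX A B C D X Y Z x z) (mulX A B C D X Y Z x' z') = inner D z (inner B x x' • z') := by
  apply ofB_injective (A := C) (X := Y)
  rw [← inner_PZQ_eq_ofB, ← inner_QZQ_eq_ofB, coe_mulX, coe_mulX, hZ.inner_lsmul_left,
    ← hZ.mul_lsmul, star_ofX_mul_ofX]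
  rfl

theorem inner_mulY (w : PZP A B C D X Y Z) (y : Y) (w' : PZP A B C D X Y Z) (y' : Y) :
    inner D (mulY A B C D X Y Z w y) (mulY A B C D X Y Z w' y') = inner D y (inner C w w' • y') := by
  apply ofB_injective (A := C) (X := Y)
  rw [← inner_PZQ_eq_ofB, coe_mulY, coe_mulY, inner_rsmul_left, inner_rsmul_right, inner_PZP_eq_ofA,
    ofA_mul_ofX, star_ofX_mul_ofX]

end Corners

end HilbertBimod

end
theorem proposition4p3 {A B C D X Y Z : Type*} [NonUnitalCStarAlgebra A] [NonUnitalCStarAlgebra B]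
    [NonUnitalCStarAlgebra C] [NonUnitalCStarAlgebra D]
    [NormedAddCommGroup X] [NormedSpace ℂ X] [SMul A X] [SMul Bᵐᵒᵖ X]
    [HilbertBimod.LeftInner A X] [Inner B X] [HilbertBimod.IsImprimitivityBimodule A B X]
    [NormedAddCommGroup Y] [NormedSpace ℂ Y] [SMul C Y] [SMul Dᵐᵒᵖ Y]
    [HilbertBimod.LeftInner C Y] [Inner D Y] [HilbertBimod.IsImprimitivityBimodule C D Y]
    [NormedAddCommGroup Z] [NormedSpace ℂ Z] [SMul (HilbertBimod.Linking A B X) Z]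
    [SMul (HilbertBimod.Linking C D Y)ᵐᵒᵖ Z] [Inner (HilbertBimod.Linking C D Y) Z]
    [HilbertBimod.IsRightHilbertBimodule (HilbertBimod.Linking A B X)
      (HilbertBimod.Linking C D Y) Z] :
    ∃ (_ : HilbertBimod.IsRightHilbertBimodule A C (HilbertBimod.PZP A B C D X Y Z))
      (_ : HilbertBimod.IsRightHilbertBimodule B D (HilbertBimod.QZQ A B C D X Y Z))
      (_ : HilbertBimod.IsRightHilbertBimodule A D (HilbertBimod.PZQ A B C D X Y Z)),
      (∀ v w : HilbertBimod.PZP A B C D X Y Z,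
        inner (HilbertBimod.Linking C D Y) (v : Z) (w : Z) =
          HilbertBimod.Linking.ofA C D Y (inner C v w)) ∧
      (∀ v w : HilbertBimod.QZQ A B C D X Y Z,
        inner (HilbertBimod.Linking C D Y) (v : Z) (w : Z) =
          HilbertBimod.Linking.ofB C D Y (inner D v w)) ∧
      (∀ v w : HilbertBimod.PZQ A B C D X Y Z,
        inner (HilbertBimod.Linking C D Y) (v : Z) (w : Z) =
          HilbertBimod.Linking.ofB C D Y (inner D v w)) ∧
      (∃ Φ : HilbertBimod.RightHilbertIso A D
          (HilbertBimod.InternalTensor B D X (HilbertBimod.QZQ A B C D X Y Z))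
          (HilbertBimod.PZQ A B C D X Y Z),
        ∀ (x : X) (z : HilbertBimod.QZQ A B C D X Y Z),
          (Φ.toLinearEquiv (HilbertBimod.InternalTensor.tmul B D X _ x z) : Z) =
            HilbertBimod.Linking.ofX A B X x • (z : Z)) ∧
      (∃ Ψ : HilbertBimod.RightHilbertIso A D
          (HilbertBimod.InternalTensor C D (HilbertBimod.PZP A B C D X Y Z) Y)
          (HilbertBimod.PZQ A B C D X Y Z),
        ∀ (w : HilbertBimod.PZP A B C D X Y Z) (y : Y),
          (Ψ.toLinearEquiv (HilbertBimod.InternalTensor.tmul C D _ Y w y) : Z) =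
            (w : Z) <• HilbertBimod.Linking.ofX C D Y y) := by
  refine ⟨inferInstance, inferInstance, inferInstance, HilbertBimod.inner_PZP_eq_ofA,
    HilbertBimod.inner_QZQ_eq_ofB, HilbertBimod.inner_PZQ_eq_ofB, ?_, ?_⟩
  · obtain ⟨Φ, hΦ⟩ := HilbertBimod.exists_iso_internalTensor (A := A)
      (HilbertBimod.mulX A B C D X Y Z)
      (fun a x z => Subtype.ext <| by
        change HilbertBimod.Linking.ofX A B X (a • x) • (z : Z) =
          HilbertBimod.Linking.ofA A B X a • (HilbertBimod.Linking.ofX A B X x • (z : Z))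
        rw [← HilbertBimod.Linking.ofA_mul_ofX,
          HilbertBimod.IsAdjointableAction.mul_lsmul (B := HilbertBimod.Linking C D Y)])
      (fun x z d => Subtype.ext
        (HilbertBimod.IsAdjointableAction.lsmul_rsmul (HilbertBimod.Linking.ofX A B X x) (z : Z)
          (HilbertBimod.Linking.ofB C D Y d)))
      HilbertBimod.inner_mulX HilbertBimod.dense_span_mulX
    exact ⟨Φ, fun x z => congrArg Subtype.val (hΦ x z)⟩
  · obtain ⟨Ψ, hΨ⟩ := HilbertBimod.exists_iso_internalTensor (A := A)
      (HilbertBimod.mulY A B C D X Y Z)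
      (fun a w y => Subtype.ext
        (HilbertBimod.IsAdjointableAction.lsmul_rsmul (HilbertBimod.Linking.ofA A B X a) (w : Z)
          (HilbertBimod.Linking.ofX C D Y y)).symm)
      (fun w y d => Subtype.ext <| by
        change (w : Z) <• HilbertBimod.Linking.ofX C D Y (y <• d) =
          ((w : Z) <• HilbertBimod.Linking.ofX C D Y y) <• HilbertBimod.Linking.ofB C D Y d
        rw [← HilbertBimod.Linking.ofX_mul_ofB, HilbertBimod.IsPreHilbertModule.rsmul_mul])
      HilbertBimod.inner_mulY HilbertBimod.dense_span_mulY
    exact ⟨Ψ, fun w y => congrArg Subtype.val (hΨ w y)⟩
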